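/- A compact line is a linearly ordered set that is compact in its order topology; the weight of a topological space is the least cardinality of a base of it. For $A \subseteq (0,1)$ let $I_A = ([0,1]\times\{0\}) \cup (A\times\{1\})$, with the order topology given by the lexicographic order. For a compact space $K$, $C(K)$ is the Banach space of real-valued continuous functions on $K$ with the supremum norm, and $X \simeq Y$ means that the Banach spaces $X$ and $Y$ are linearly homeomorphic. A set $B \subseteq (0,1)$ is $\omega_1$-dense in $(0,1)$ if $|U \cap B| = \omega_1$ for every nonempty open set $U \subseteq (0,1)$. Then (in ZFC): (1) For every separable compact line $K$ of weight $\omega_1$ there is a set $B \subseteq (0,1)$ that is $\omega_1$-dense in $(0,1)$ and satisfies $C(K) \simeq C(I_B)$. (2) For every uncountable separable compact line $L$ there is a set $A \subseteq (0,1)$ with $C(L) \simeq C(I_A)$. -/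

import Mathlib

open Set TopologicalSpace Cardinal

universe u

/-- The weight of a topological space: the least cardinality of a base of its topology. -/
noncomputable def topWeight (X : Type u) [TopologicalSpace X] : Cardinal.{u} :=
  sInf {c : Cardinal.{u} | ∃ 𝓑 : Set (Set X), IsTopologicalBasis 𝓑 ∧ #𝓑 = c}

/-- `A` is `κ`-dense in the space `X`: it meets every nonempty open set in exactly `κ` points. -/
def IsCardDense {X : Type u} [TopologicalSpace X] (κ : Cardinal.{u}) (A : Set X) : Prop :=
  ∀ U : Set X, IsOpen U → U.Nonempty → #(U ∩ A : Set X) = κ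

/-- The set `K_A = (K × {0}) ∪ (A × {1})` for sets of reals `K` and `A` (used when `A ⊆ K`),
inside `ℝ × {0,1}` with the lexicographic order. -/
def SplitLine (K A : Set ℝ) : Type :=
  {p : ℝ ×ₗ Fin 2 // ((ofLex p).1 ∈ K ∧ (ofLex p).2 = 0) ∨ ((ofLex p).1 ∈ A ∧ (ofLex p).2 = 1)}

/-- The lexicographic order on `K_A`. -/
noncomputable instance (K A : Set ℝ) : LinearOrder (SplitLine K A) :=
  inferInstanceAs (LinearOrder {p : ℝ ×ₗ Fin 2 //
    ((ofLex p).1 ∈ K ∧ (ofLex p).2 = 0) ∨ ((ofLex p).1 ∈ A ∧ (ofLex p).2 = 1)})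

/-- `K_A` carries the order topology of its own (lexicographic) order. -/
noncomputable instance (K A : Set ℝ) : TopologicalSpace (SplitLine K A) := Preorder.topology _

instance (K A : Set ℝ) : OrderTopology (SplitLine K A) := ⟨rfl⟩

/-- The space `I_A`, where `I = [0,1]`. -/
abbrev SplitUnitInterval (A : Set ℝ) : Type := SplitLine (Icc 0 1) A

/-- The spaces `C(X)` and `C(Y)` of real continuous functions are linearly homeomorphic.
Mathlib's topology on `C(X, ℝ)` is the compact-open one, which for compact `X` is the topology
of the supremum norm. -/
def CIsomorphic (X Y : Type*) [TopologicalSpace X] [TopologicalSpace Y] : Prop :=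
  Nonempty (C(X, ℝ) ≃L[ℝ] C(Y, ℝ))

open Filter Topology MeasureTheory

/-! ### Complemented subspaces and the decomposition method -/

/-- `X` is linearly homeomorphic to a complemented subspace of `Y`. -/
def EmbedsComplemented (X Y : Type*) [AddCommGroup X] [Module ℝ X] [TopologicalSpace X]
    [AddCommGroup Y] [Module ℝ Y] [TopologicalSpace Y] : Prop :=
  ∃ (i : X →L[ℝ] Y) (r : Y →L[ℝ] X), ∀ x, r (i x) = x

theorem EmbedsComplemented.trans {X Y Z : Type*} [AddCommGroup X] [Module ℝ X]
    [TopologicalSpace X] [AddCommGroup Y] [Module ℝ Y] [TopologicalSpace Y]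
    [AddCommGroup Z] [Module ℝ Z] [TopologicalSpace Z]
    (h₁ : EmbedsComplemented X Y) (h₂ : EmbedsComplemented Y Z) : EmbedsComplemented X Z := by
  obtain ⟨i, r, h⟩ := h₁
  obtain ⟨i', r', h'⟩ := h₂
  exact ⟨i'.comp i, r.comp r', fun x => by simp [h, h']⟩

theorem EmbedsComplemented.exists_equiv_prod {X Y : Type*} [AddCommGroup X] [Module ℝ X]
    [TopologicalSpace X] [AddCommGroup Y] [Module ℝ Y] [TopologicalSpace Y]
    [IsTopologicalAddGroup Y] (h : EmbedsComplemented X Y) :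
    ∃ Z : Submodule ℝ Y, Nonempty (Y ≃L[ℝ] X × Z) := by
  obtain ⟨i, r, h⟩ := h
  exact ⟨_, ⟨ContinuousLinearEquiv.equivOfRightInverse r i h⟩⟩

/-- Precomposition with a continuous map, as a continuous linear map. -/
def precompCLM {X Y : Type*} [TopologicalSpace X] [TopologicalSpace Y] (V : Type*)
    [AddCommGroup V] [Module ℝ V] [TopologicalSpace V] [IsTopologicalAddGroup V]
    [ContinuousSMul ℝ V] (g : C(X, Y)) : C(Y, V) →L[ℝ] C(X, V) where
  toFun f := f.comp g
  map_add' _ _ := rfl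
  map_smul' _ _ := rfl
  cont := ContinuousMap.continuous_precomp g

@[simp] theorem precompCLM_apply {X Y : Type*} [TopologicalSpace X] [TopologicalSpace Y]
    (V : Type*) [AddCommGroup V] [Module ℝ V] [TopologicalSpace V] [IsTopologicalAddGroup V]
    [ContinuousSMul ℝ V] (g : C(X, Y)) (f : C(Y, V)) (x : X) : precompCLM V g f x = f (g x) := rfl

/-- The shift on convergent sequences. -/
noncomputable def onePointShift : C(OnePoint ℕ, OnePoint ℕ) :=
  OnePoint.continuousMapMkNat (fun n => ((n + 1 : ℕ) : OnePoint ℕ)) OnePoint.infty (by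
    have := (OnePoint.continuous_iff_from_nat (id : OnePoint ℕ → OnePoint ℕ)).1 continuous_id
    exact (tendsto_add_atTop_iff_nat (f := fun n : ℕ => (n : OnePoint ℕ)) 1).2 this)

@[simp] theorem onePointShift_coe (n : ℕ) :
    onePointShift (n : OnePoint ℕ) = ((n + 1 : ℕ) : OnePoint ℕ) := rfl

@[simp] theorem onePointShift_infty : onePointShift OnePoint.infty = OnePoint.infty := rfl

/-- Split each term of a convergent sequence along `V = i(X) ⊕ ker r` and shift only the
`i(X)`-components by one place. What the shift loses is the component at index `0`, an arbitrary
element of `X`, and this is the second coordinate. -/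
theorem convergentSequences_equiv_prod {X V : Type*} [NormedAddCommGroup X] [NormedSpace ℝ X]
    [CompleteSpace X] [NormedAddCommGroup V] [NormedSpace ℝ V] [CompleteSpace V]
    (h : EmbedsComplemented X V) :
    Nonempty (C(OnePoint ℕ, V) ≃L[ℝ] C(OnePoint ℕ, V) × X) := by
  obtain ⟨i, r, h⟩ := h
  let p : V →L[ℝ] V := i.comp r
  have hp : ∀ v, p (p v) = p v := fun v => by simp [p, h]
  have hpi : ∀ x, p (i x) = i x := fun x => by simp [p, h]
  have hrp : ∀ v, r (p v) = r v := fun v => by simp [p, h]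
  let A : C(OnePoint ℕ, V) →L[ℝ] C(OnePoint ℕ, V) :=
    (ContinuousLinearMap.id ℝ V - p).compLeftContinuous ℝ (OnePoint ℕ)
      + (p.compLeftContinuous ℝ (OnePoint ℕ)).comp
        (precompCLM V onePointShift)
  let ev : C(OnePoint ℕ, V) →L[ℝ] V := ContinuousMap.evalCLM ℝ ((0 : ℕ) : OnePoint ℕ)
  let T := A.prod (r.comp ev)
  have hA : ∀ v x, A v x = v x - p (v x) + p (v (onePointShift x)) := fun v x => rfl
  have hT : ∀ v, T v = (A v, r (v ((0 : ℕ) : OnePoint ℕ))) := fun v => rfl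
  refine ⟨ContinuousLinearEquiv.ofBijective T ?_ ?_⟩
  · rw [LinearMap.ker_eq_bot']
    intro v hv
    have hv : T v = 0 := hv
    rw [hT, Prod.mk_eq_zero] at hv
    have h1 : ∀ x, v x - p (v x) + p (v (onePointShift x)) = 0 := fun x => by
      rw [← hA, hv.1]; rfl
    have h2 : ∀ x, p (v (onePointShift x)) = 0 := fun x => by
      have := congrArg p (h1 x)
      simpa [hp] using this
    have h3 : ∀ x, p (v x) = 0 → v x = 0 := fun x hx => by
      have := h1 x
      simpa [hx, h2 x] using this
    ext x
    induction x using OnePoint.rec with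
    | infty => exact h3 _ (by simpa using h2 OnePoint.infty)
    | coe n =>
      cases n with
      | zero => exact h3 _ (by simp only [p, ContinuousLinearMap.comp_apply]; rw [hv.2, map_zero])
      | succ n => exact h3 _ (by simpa using h2 (n : OnePoint ℕ))
  · rw [LinearMap.range_eq_top]
    rintro ⟨w, x⟩
    -- The inverse shift: `i x` is inserted at index `0` and the `i(X)`-components of `w` move up by
    -- one.
    let u : C(OnePoint ℕ, V) := OnePoint.continuousMapMkNat
      (fun n => Nat.casesOn n (i x) (fun m => p (w (m : OnePoint ℕ)))) (p (w OnePoint.infty)) (by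
        refine (tendsto_add_atTop_iff_nat 1).1 ?_
        exact (p.continuous.tendsto _).comp
          ((OnePoint.continuous_iff_from_nat w).1 w.continuous))
    have hu0 : u ((0 : ℕ) : OnePoint ℕ) = i x := rfl
    have hus : ∀ y, u (onePointShift y) = p (w y) := fun y => by
      induction y using OnePoint.rec with
      | infty => rfl
      | coe n => rfl
    have hpu : ∀ y, p (u y) = u y := fun y => by
      induction y using OnePoint.rec with
      | infty => exact hp _
      | coe n =>
        cases n with
        | zero => exact hpi x
        | succ n => exact hp _
    refine ⟨(ContinuousLinearMap.id ℝ V - p).compLeftContinuous ℝ (OnePoint ℕ) w + u, ?_⟩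
    have hval : ∀ y, ((ContinuousLinearMap.id ℝ V - p).compLeftContinuous ℝ (OnePoint ℕ) w + u) y
        = w y - p (w y) + u y := fun y => rfl
    change T _ = _
    rw [hT]
    refine Prod.ext ?_ ?_
    · ext y
      change A _ y = w y
      rw [hA, hval, hval]
      simp [hp, hpu, hus]
    · change r _ = x
      rw [hval, hu0, ← hrp]
      simp [hp, hpi, h]

/-- Writing `c(V)` for the convergent sequences, `W ≃ c(V) × Z` for some `Z`, and `c(V) ≃ c(V) × X`
splits off the copy of `X`. -/
theorem nonempty_equiv_prod_of_embedsComplemented {X V W : Type*} [NormedAddCommGroup X]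
    [NormedSpace ℝ X] [CompleteSpace X] [NormedAddCommGroup V] [NormedSpace ℝ V] [CompleteSpace V]
    [NormedAddCommGroup W] [NormedSpace ℝ W] (hXV : EmbedsComplemented X V)
    (hV : EmbedsComplemented C(OnePoint ℕ, V) V) (hVW : EmbedsComplemented V W) :
    Nonempty (W ≃L[ℝ] W × X) := by
  obtain ⟨Z, ⟨e⟩⟩ := (hV.trans hVW).exists_equiv_prod
  obtain ⟨s⟩ := convergentSequences_equiv_prod hXV
  refine ⟨e.trans (((s.prodCongr (.refl ℝ Z)).trans ?_).trans (e.symm.prodCongr (.refl ℝ X)))⟩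
  exact (ContinuousLinearEquiv.prodAssoc ℝ _ _ _).trans
    (((ContinuousLinearEquiv.refl ℝ _).prodCongr (ContinuousLinearEquiv.prodComm ℝ X Z)).trans
      (ContinuousLinearEquiv.prodAssoc ℝ _ _ _).symm)

/-! ### Retractions and averaging operators -/

theorem embedsComplemented_of_retract {X Y : Type*} [TopologicalSpace X] [TopologicalSpace Y]
    (s : C(X, Y)) (ρ : C(Y, X)) (h : ∀ x, ρ (s x) = x) : EmbedsComplemented C(X, ℝ) C(Y, ℝ) :=
  ⟨precompCLM ℝ ρ,
    precompCLM ℝ s, fun f => by ext x; simp [h]⟩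

/-- Averaging operators: if `e · ω` is a family of sections whose members are almost surely
continuous at each given point in the weak sense tested by continuous functions,
then integrating over `ω` maps continuous functions to continuous functions. -/
theorem exists_averaging {X Y Ω : Type*} [TopologicalSpace X] [CompactSpace X]
    [TopologicalSpace Y] [CompactSpace Y] [FirstCountableTopology Y] [MeasurableSpace Ω]
    (μ : Measure Ω) [IsProbabilityMeasure μ] (e : Y → Ω → X)
    (hm : ∀ (f : C(X, ℝ)) y, AEStronglyMeasurable (fun ω => f (e y ω)) μ)
    (hc : ∀ (f : C(X, ℝ)) y, ∀ᵐ ω ∂μ, ContinuousAt (fun y => f (e y ω)) y) :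
    ∃ P : C(X, ℝ) →L[ℝ] C(Y, ℝ), ∀ f y, P f y = ∫ ω, f (e y ω) ∂μ := by
  have hint : ∀ (f : C(X, ℝ)) y, Integrable (fun ω => f (e y ω)) μ := fun f y =>
    Integrable.of_bound (hm f y) ‖f‖ (Eventually.of_forall fun ω => f.norm_coe_le_norm _)
  let P : C(X, ℝ) →ₗ[ℝ] C(Y, ℝ) :=
    { toFun := fun f => ⟨fun y => ∫ ω, f (e y ω) ∂μ, continuous_iff_continuousAt.2 fun y =>
        continuousAt_of_dominated (bound := fun _ => ‖f‖) (Eventually.of_forall fun y => hm f y)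
          (Eventually.of_forall fun y => Eventually.of_forall fun ω => f.norm_coe_le_norm _)
          (integrable_const _) (hc f y)⟩
      map_add' := fun f g => by
        ext y
        exact integral_add (hint f y) (hint g y)
      map_smul' := fun c f => by
        ext y
        exact integral_const_mul c _ }
  refine ⟨P.mkContinuous 1 fun f => ?_, fun f y => rfl⟩
  rw [one_mul, ContinuousMap.norm_le _ (norm_nonneg _)]
  intro y
  have := norm_integral_le_of_norm_le_const (μ := μ) (f := fun ω => f (e y ω)) (C := ‖f‖)
    (Eventually.of_forall fun ω => f.norm_coe_le_norm _)
  rwa [probReal_univ, mul_one] at this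

/-- The points `e y ω` play the role of a random section: `T g` takes the value `g y` at almost all
of them, so averaging over `ω` is a left inverse of `T`. No single section has to be continuous. -/
theorem embedsComplemented_of_averaging {X Y Ω : Type*} [TopologicalSpace X] [CompactSpace X]
    [TopologicalSpace Y] [CompactSpace Y] [FirstCountableTopology Y] [MeasurableSpace Ω]
    (μ : Measure Ω) [IsProbabilityMeasure μ] (e : Y → Ω → X)
    (hm : ∀ (f : C(X, ℝ)) y, AEStronglyMeasurable (fun ω => f (e y ω)) μ)
    (hc : ∀ (f : C(X, ℝ)) y, ∀ᵐ ω ∂μ, ContinuousAt (fun y => f (e y ω)) y)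
    (T : C(Y, ℝ) →L[ℝ] C(X, ℝ)) (hT : ∀ g y, ∀ᵐ ω ∂μ, T g (e y ω) = g y) :
    EmbedsComplemented C(Y, ℝ) C(X, ℝ) := by
  obtain ⟨P, hP⟩ := exists_averaging μ e hm hc
  refine ⟨T, P, fun g => ?_⟩
  ext y
  rw [hP, integral_congr_ae (hT g y)]
  simp

/-! ### Cantor space and Milutin's theorem -/

/-- The Cantor space of binary sequences. -/
abbrev BinarySeq : Type := ℕ → Fin 2

/-- Lebesgue measure on `[0, 1)`. -/
noncomputable def unitVolume : Measure ℝ := volume.restrict (Ico 0 1)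

instance : IsProbabilityMeasure unitVolume := ⟨by simp [unitVolume]⟩

theorem ae_unitVolume_mem : ∀ᵐ θ ∂unitVolume, θ ∈ Ico (0 : ℝ) 1 :=
  ae_restrict_mem measurableSet_Ico

theorem ae_unitVolume_notMem_of_countable {s : Set ℝ} (hs : s.Countable) :
    ∀ᵐ θ ∂unitVolume, θ ∉ s :=
  measure_eq_zero_iff_ae_notMem.1 <| by
    rw [unitVolume]
    exact nonpos_iff_eq_zero.1 ((Measure.restrict_apply_le _ _).trans_eq (hs.measure_zero volume))

/-- The set of dyadic rationals in `[0, ∞)`. -/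
def dyadics : Set ℝ := {x | ∃ n m : ℕ, x = m / 2 ^ n}

theorem countable_dyadics : dyadics.Countable := by
  have : dyadics ⊆ range (fun p : ℕ × ℕ => (p.2 : ℝ) / 2 ^ p.1) := by
    rintro x ⟨n, m, rfl⟩
    exact ⟨(n, m), rfl⟩
  exact (countable_range _).mono this

theorem continuousAt_digits {x : ℝ} (hx : 0 ≤ x) (hd : x ∉ dyadics) :
    ContinuousAt (fun x => Real.digits x 2) x := by
  rw [continuousAt_pi]
  intro n
  have hne : x * 2 ^ (n + 1) ≠ ⌊x * 2 ^ (n + 1)⌋₊ := fun h =>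
    hd ⟨n + 1, ⌊x * 2 ^ (n + 1)⌋₊, by rw [← h]; field_simp⟩
  have h0 : 0 ≤ x * 2 ^ (n + 1) := by positivity
  have hmem : ∀ᶠ y in 𝓝 x, y * 2 ^ (n + 1) ∈
      Ioo (⌊x * 2 ^ (n + 1)⌋₊ : ℝ) (⌊x * 2 ^ (n + 1)⌋₊ + 1) :=
    (continuous_id.mul continuous_const).continuousAt.eventually
      (Ioo_mem_nhds (lt_of_le_of_ne (Nat.floor_le h0) hne.symm) (Nat.lt_floor_add_one _))
  have hev : (fun _ => Real.digits x 2 n) =ᶠ[𝓝 x] fun y => Real.digits y 2 n := by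
    filter_upwards [hmem] with y hy
    have : ⌊y * 2 ^ (n + 1)⌋₊ = ⌊x * 2 ^ (n + 1)⌋₊ :=
      (Nat.floor_eq_iff ((Nat.cast_nonneg _).trans hy.1.le)).2 ⟨hy.1.le, hy.2⟩
    simp [Real.digits, this]
  exact continuousAt_const.congr hev

theorem measurable_digits : Measurable fun x : ℝ => Real.digits x 2 := by
  refine measurable_pi_lambda _ fun n => ?_
  exact (measurable_of_countable (fun k : ℕ => Fin.ofNat 2 k)).comp
    (Nat.measurable_floor.comp (measurable_id.mul_const _))

theorem injOn_digits : InjOn (fun x => Real.digits x 2) (Ico 0 1) := fun x hx y hy h => by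
  rw [← Real.ofDigits_digits one_lt_two hx, ← Real.ofDigits_digits one_lt_two hy]
  exact congrArg _ h

/-- Interleaving of two binary sequences. -/
def interleave : BinarySeq × BinarySeq ≃ₜ BinarySeq :=
  Homeomorph.sumArrowHomeomorphProdArrow.symm.trans
    (Homeomorph.piCongrLeft (Y := fun _ => Fin 2) Equiv.natSumNatEquivNat)

theorem embedsComplemented_of_homeomorph {X Y : Type*} [TopologicalSpace X] [TopologicalSpace Y]
    (h : X ≃ₜ Y) : EmbedsComplemented C(X, ℝ) C(Y, ℝ) :=
  embedsComplemented_of_retract ⟨h, h.continuous⟩ ⟨h.symm, h.symm.continuous⟩ (by simp)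

/-- Milutin's theorem for the unit interval. -/
theorem embedsComplemented_unitInterval_binarySeq :
    EmbedsComplemented C(Icc (0 : ℝ) 1, ℝ) C(BinarySeq, ℝ) := by
  refine EmbedsComplemented.trans ?_ (embedsComplemented_of_homeomorph interleave)
  -- The pair encodes `θ` and `(x + θ) / 2`, from which `x` is recovered as `2 * ((x + θ) / 2) - θ`.
  -- Halving keeps the sum in `[0,1)`, and the random translation makes `(x + θ) / 2` non-dyadic for
  -- almost every `θ`, whatever `x` is.
  let e : Icc (0 : ℝ) 1 → ℝ → BinarySeq × BinarySeq := fun x θ =>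
    (Real.digits θ 2, Real.digits ((x + θ) / 2) 2)
  have he : ∀ x, Measurable (e x) := fun x => measurable_digits.prodMk
    (measurable_digits.comp ((measurable_const.add measurable_id).div_const 2))
  let π : C(BinarySeq × BinarySeq, Icc (0 : ℝ) 1) :=
    ⟨fun d => projIcc 0 1 zero_le_one (2 * Real.ofDigits d.2 - Real.ofDigits d.1),
      continuous_projIcc.comp (by
        have := Real.continuous_ofDigits (b := 2)
        fun_prop)⟩
  refine embedsComplemented_of_averaging unitVolume e
    (fun f x => (f.continuous.measurable.comp (he x)).aestronglyMeasurable) (fun f x => ?_)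
    (precompCLM ℝ π) (fun g x => ?_)
  · have hc : ((fun θ : ℝ => ((x : ℝ) + θ) / 2) ⁻¹' dyadics).Countable :=
      countable_dyadics.preimage_of_injOn fun a _ b _ h => by
        have : ((x : ℝ) + a) / 2 = (x + b) / 2 := h
        linarith
    filter_upwards [ae_unitVolume_mem, ae_unitVolume_notMem_of_countable hc] with θ hθ hd
    refine f.continuous.continuousAt.comp (continuousAt_const.prodMk ?_)
    exact (continuousAt_digits (x := ((x : ℝ) + θ) / 2)
      (by have := x.2.1; have := hθ.1; positivity) hd).comp
      (f := fun y : Icc (0 : ℝ) 1 => ((y : ℝ) + θ) / 2) (by fun_prop)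
  · filter_upwards [ae_unitVolume_mem] with θ hθ
    have h2 : ((x : ℝ) + θ) / 2 ∈ Ico (0 : ℝ) 1 := by
      have := x.2.1; have := x.2.2; have := hθ.1; have := hθ.2
      constructor <;> linarith
    have : π (e x θ) = x := by
      change projIcc 0 1 zero_le_one (2 * Real.ofDigits (Real.digits (((x : ℝ) + θ) / 2) 2)
        - Real.ofDigits (Real.digits θ 2)) = x
      rw [Real.ofDigits_digits one_lt_two hθ, Real.ofDigits_digits one_lt_two h2]
      convert projIcc_val zero_le_one x using 2
      ring
    simp [this]

/-- `n` is sent to the indicator of `{n}` and `∞` to the zero sequence. -/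
noncomputable def onePointEmbedding : C(OnePoint ℕ, BinarySeq) :=
  OnePoint.continuousMapMkNat (fun n => Pi.single n 1) 0 (by
    rw [tendsto_pi_nhds]
    intro k
    refine tendsto_const_nhds.congr' ?_
    filter_upwards [eventually_gt_atTop k] with n hn
    simp [hn.ne])

theorem onePointEmbedding_injective : Function.Injective onePointEmbedding := by
  have h0 : onePointEmbedding OnePoint.infty = 0 := rfl
  have hn : ∀ n : ℕ, onePointEmbedding n = Pi.single n 1 := fun n => rfl
  have hs : ∀ n : ℕ, (Pi.single n 1 : BinarySeq) ≠ 0 := fun n h => by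
    have := congrFun h n
    simp at this
  intro x y h
  induction x using OnePoint.rec with
  | infty =>
    induction y using OnePoint.rec with
    | infty => rfl
    | coe m => exact absurd ((hn m).symm.trans (h.symm.trans h0)) (hs m)
  | coe n =>
    induction y using OnePoint.rec with
    | infty => exact absurd ((hn n).symm.trans (h.trans h0)) (hs n)
    | coe m =>
      have := congrFun ((hn n).symm.trans (h.trans (hn m))) n
      by_contra hne
      have hne : n ≠ m := fun h => hne (by rw [h])
      simp [hne] at this

/-- Nonempty closed subsets of Cantor space are retracts of it. -/
theorem embedsComplemented_of_injective_binarySeq {X : Type*} [TopologicalSpace X] [CompactSpace X]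
    [Nonempty X] (f : C(X, BinarySeq)) (hf : Function.Injective f) :
    EmbedsComplemented C(X, ℝ) C(BinarySeq, ℝ) := by
  have hcl : IsClosedEmbedding f := f.continuous.isClosedEmbedding hf
  obtain ⟨ρ, hρ, -, hρc⟩ := PiNat.exists_retraction_subtype_of_isClosed (E := fun _ => Fin 2)
    hcl.isClosed_range (range_nonempty f)
  let h : X ≃ₜ range f := hcl.isEmbedding.toHomeomorph
  refine (embedsComplemented_of_homeomorph h).trans
    (embedsComplemented_of_retract ⟨Subtype.val, continuous_subtype_val⟩ ⟨ρ, hρc⟩ hρ)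

/-- By currying, the left side is `C((ω + 1) × Δ)`, and `(ω + 1) × Δ` embeds in `Δ × Δ`, a copy of
`Δ`. -/
theorem embedsComplemented_convergentSequences_binarySeq :
    EmbedsComplemented C(OnePoint ℕ, C(BinarySeq, ℝ)) C(BinarySeq, ℝ) := by
  have h1 : EmbedsComplemented C(OnePoint ℕ × BinarySeq, ℝ) C(BinarySeq, ℝ) := by
    let j : C(OnePoint ℕ × BinarySeq, BinarySeq) :=
      ⟨fun p => interleave (onePointEmbedding p.1, p.2), by
        have := interleave.continuous
        fun_prop⟩
    refine embedsComplemented_of_injective_binarySeq j fun p q h => ?_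
    have := interleave.injective h
    rw [Prod.mk.injEq] at this
    exact Prod.ext (onePointEmbedding_injective this.1) this.2
  refine EmbedsComplemented.trans ?_ h1
  let U : C(OnePoint ℕ, C(BinarySeq, ℝ)) →L[ℝ] C(OnePoint ℕ × BinarySeq, ℝ) :=
    { toFun := ContinuousMap.uncurry
      map_add' := fun _ _ => rfl
      map_smul' := fun _ _ => rfl
      cont := ContinuousMap.continuous_uncurry }
  let W : C(OnePoint ℕ × BinarySeq, ℝ) →L[ℝ] C(OnePoint ℕ, C(BinarySeq, ℝ)) :=
    { toFun := ContinuousMap.curry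
      map_add' := fun _ _ => rfl
      map_smul' := fun _ _ => rfl
      cont := ContinuousMap.continuous_curry }
  exact ⟨U, W, fun f => rfl⟩

/-- The space of continuous functions on the Cantor space is absorbed by any Banach space
containing it as a complemented subspace. -/
theorem nonempty_equiv_prod_of_binarySeq {X W : Type*} [NormedAddCommGroup X]
    [NormedSpace ℝ X] [CompleteSpace X] [NormedAddCommGroup W] [NormedSpace ℝ W]
    (hX : EmbedsComplemented X C(BinarySeq, ℝ)) (hW : EmbedsComplemented C(BinarySeq, ℝ) W) :
    Nonempty (W ≃L[ℝ] W × X) :=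
  nonempty_equiv_prod_of_embedsComplemented hX embedsComplemented_convergentSequences_binarySeq hW

/-! ### Extension operators on compact lines -/

section CompactLine

variable {K : Type*} [LinearOrder K] [TopologicalSpace K] [OrderTopology K] [CompactSpace K]

theorem IsClosed.exists_isGreatest_inter_Iic {E : Set K} (hE : IsClosed E) {a x : K} (ha : a ∈ E)
    (hax : a ≤ x) : ∃ l, IsGreatest (E ∩ Iic x) l :=
  (hE.inter isClosed_Iic).isCompact.exists_isGreatest ⟨a, ha, hax⟩

theorem IsClosed.exists_isLeast_inter_Ici {E : Set K} (hE : IsClosed E) {a x : K} (ha : a ∈ E)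
    (hax : x ≤ a) : ∃ l, IsLeast (E ∩ Ici x) l :=
  (hE.inter isClosed_Ici).isCompact.exists_isLeast ⟨a, ha, hax⟩

/-- Either `E` has a gap immediately to the right of `x`, where continuity is assumed, or `x` is a
limit of points of `E` from the right. In the latter case a nearby `y` lies between neighbouring
points of `E` at which `f` is already close to `f x`, and `f y` lies between those two values. -/
theorem continuousWithinAt_Ici_of_gaps {E : Set K} (hE : IsClosed E) {f : K → ℝ}
    (hfE : ContinuousOn f E)
    (hgap : ∀ a ∈ E, ∀ b ∈ E, a < b → E ∩ Ioo a b = ∅ →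
      ContinuousOn f (Icc a b) ∧ ∀ x ∈ Icc a b, f x ∈ uIcc (f a) (f b))
    {x a b : K} (ha : a ∈ E) (hax : a ≤ x) (hb : b ∈ E) (hxb : x < b) :
    ContinuousWithinAt f (Ici x) x := by
  by_cases hA : ∃ e ∈ E, x < e ∧ E ∩ Ioo x e = ∅
  · obtain ⟨e, heE, hxe, he⟩ := hA
    obtain ⟨l, hl⟩ := hE.exists_isGreatest_inter_Iic ha hax
    have hlx : l ≤ x := hl.1.2
    have hemp : E ∩ Ioo l e = ∅ := by
      rw [eq_empty_iff_forall_notMem] at he ⊢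
      rintro y ⟨hyE, hly, hye⟩
      rcases le_or_gt y x with h | h
      · exact (hl.2 ⟨hyE, h⟩).not_gt hly
      · exact he y ⟨hyE, h, hye⟩
    exact ((hgap l hl.1.1 e heE (hlx.trans_lt hxe) hemp).1 x ⟨hlx, hxe.le⟩).mono_of_mem_nhdsWithin
      (Icc_mem_nhdsGE_of_mem ⟨hlx, hxe⟩)
  · push Not at hA
    have hacc : ∀ u, x < u → ∃ e ∈ E, x < e ∧ e < u := by
      intro u hu
      by_contra! h
      obtain ⟨e, he⟩ := hE.exists_isLeast_inter_Ici hb (h b hb hxb)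
      obtain ⟨y, hyE, hxy, hye⟩ := hA e he.1.1 (hu.trans_le he.1.2)
      exact (he.2 ⟨hyE, h y hyE hxy⟩).not_gt hye
    have hxE : x ∈ E := by
      by_contra hx
      obtain ⟨u, hu, hsub⟩ := exists_Ico_subset_of_mem_nhds (hE.isOpen_compl.mem_nhds hx) ⟨b, hxb⟩
      obtain ⟨e, he, hxe, heu⟩ := hacc u hu
      exact hsub ⟨hxe.le, heu⟩ he
    rw [Metric.continuousWithinAt_iff']
    intro ε hε
    have h1 := Metric.continuousWithinAt_iff'.1 (hfE x hxE) ε hε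
    rw [eventually_nhdsWithin_iff] at h1
    obtain ⟨u, hu, hsub⟩ := exists_Ico_subset_of_mem_nhds h1 ⟨b, hxb⟩
    obtain ⟨e, he, hxe, heu⟩ := hacc u hu
    filter_upwards [Ico_mem_nhdsGE hxe] with y hy
    obtain ⟨l, hl⟩ := hE.exists_isGreatest_inter_Iic hxE hy.1
    obtain ⟨r, hr⟩ := hE.exists_isLeast_inter_Ici he hy.2.le
    have hlx : x ≤ l := hl.2 ⟨hxE, hy.1⟩
    have hly : l ≤ y := hl.1.2
    have hyr : y ≤ r := hr.1.2
    have hre : r ≤ e := hr.2 ⟨he, hy.2.le⟩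
    have hl' : f l ∈ Metric.ball (f x) ε := hsub ⟨hlx, (hly.trans_lt hy.2).trans heu⟩ hl.1.1
    have hr' : f r ∈ Metric.ball (f x) ε :=
      hsub ⟨hlx.trans (hly.trans hyr), hre.trans_lt heu⟩ hr.1.1
    rcases hly.eq_or_lt with rfl | hly
    · exact hl'
    have hlr : l < r := hly.trans_le hyr
    have hemp : E ∩ Ioo l r = ∅ := by
      rw [eq_empty_iff_forall_notMem]
      rintro z ⟨hz, h1, h2⟩
      rcases le_total z y with h | h
      · exact (hl.2 ⟨hz, h⟩).not_gt h1
      · exact (hr.2 ⟨hz, h⟩).not_gt h2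
    exact (convex_ball (f x) ε).ordConnected.uIcc_subset hl' hr'
      ((hgap l hl.1.1 r hr.1.1 hlr hemp).2 y ⟨hly.le, hyr⟩)

theorem continuousWithinAt_Iic_of_gaps {E : Set K} (hE : IsClosed E) {f : K → ℝ}
    (hfE : ContinuousOn f E)
    (hgap : ∀ a ∈ E, ∀ b ∈ E, a < b → E ∩ Ioo a b = ∅ →
      ContinuousOn f (Icc a b) ∧ ∀ x ∈ Icc a b, f x ∈ uIcc (f a) (f b))
    {x a b : K} (ha : a ∈ E) (hax : a < x) (hb : b ∈ E) (hxb : x ≤ b) :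
    ContinuousWithinAt f (Iic x) x := by
  have : CompactSpace Kᵒᵈ := ‹CompactSpace K›
  refine continuousWithinAt_Ici_of_gaps (K := Kᵒᵈ) (E := OrderDual.ofDual ⁻¹' E)
    (f := f ∘ OrderDual.ofDual) (x := OrderDual.toDual x) (a := OrderDual.toDual b)
    (b := OrderDual.toDual a) hE hfE ?_ hb hxb ha hax
  intro c hc d hd hcd hemp
  have h := hgap (OrderDual.ofDual d) hd (OrderDual.ofDual c) hc hcd (by
    rw [eq_empty_iff_forall_notMem] at hemp ⊢
    exact fun y hy => hemp (OrderDual.toDual y) ⟨hy.1, hy.2.2, hy.2.1⟩)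
  refine ⟨?_, fun y hy => ?_⟩
  · rw [← OrderDual.toDual_ofDual c, ← OrderDual.toDual_ofDual d, Icc_toDual]
    exact h.1
  · rw [uIcc_comm]
    exact h.2 (OrderDual.ofDual y) ⟨hy.2, hy.1⟩

theorem continuous_of_gaps {E : Set K} (hE : IsClosed E) {f : K → ℝ} (hfE : ContinuousOn f E)
    (hgap : ∀ a ∈ E, ∀ b ∈ E, a < b → E ∩ Ioo a b = ∅ →
      ContinuousOn f (Icc a b) ∧ ∀ x ∈ Icc a b, f x ∈ uIcc (f a) (f b))
    {m M : K} (hm : IsLeast E m) (hM : IsGreatest E M) (hfm : ∀ x ≤ m, f x = f m)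
    (hfM : ∀ x, M ≤ x → f x = f M) : Continuous f := by
  rw [continuous_iff_continuousAt]
  intro x
  rw [continuousAt_iff_continuous_left_right]
  constructor
  · rcases le_or_gt x m with h | h
    · exact continuousWithinAt_const.congr (fun y hy => hfm y (le_trans hy h)) (hfm x h)
    rcases le_or_gt x M with h' | h'
    · exact continuousWithinAt_Iic_of_gaps hE hfE hgap hm.1 h hM.1 h'
    · exact (continuousWithinAt_const.congr (s := Ici M) (fun y hy => hfM y hy)
        (hfM x h'.le)).mono_of_mem_nhdsWithin (mem_nhdsWithin_of_mem_nhds (Ici_mem_nhds h'))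
  · rcases le_or_gt M x with h | h
    · exact continuousWithinAt_const.congr (fun y hy => hfM y (le_trans h hy)) (hfM x h)
    rcases le_or_gt m x with h' | h'
    · exact continuousWithinAt_Ici_of_gaps hE hfE hgap hm.1 h' hM.1 h
    · exact (continuousWithinAt_const.congr (s := Iic m) (fun y hy => hfm y hy)
        (hfm x h'.le)).mono_of_mem_nhdsWithin (mem_nhdsWithin_of_mem_nhds (Iic_mem_nhds h'))

/-- Continuous functions on a closed subset of a compact line extend linearly and continuously. -/
theorem exists_extension_operator {E : Set K} (hE : IsClosed E) (hne : E.Nonempty) :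
    ∃ S : C(E, ℝ) →L[ℝ] C(K, ℝ), ∀ f (x : E), S f x = f x := by
  classical
  have : CompactSpace E := isCompact_iff_compactSpace.1 hE.isCompact
  obtain ⟨m, hm⟩ := hE.isCompact.exists_isLeast hne
  obtain ⟨M, hM⟩ := hE.isCompact.exists_isGreatest hne
  -- `l x` and `r x` are the nearest points of `E` on either side of `x`; beyond the extreme points
  -- of `E` both become that extreme point, so the extension is constant there.
  have hl : ∀ x, ∃ l : E, (m ≤ x → IsGreatest (E ∩ Iic x) l) ∧ (x < m → (l : K) = m) := fun x => by
    rcases le_or_gt m x with h | h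
    · obtain ⟨l, hl⟩ := hE.exists_isGreatest_inter_Iic hm.1 h
      exact ⟨⟨l, hl.1.1⟩, fun _ => hl, fun h' => absurd h h'.not_ge⟩
    · exact ⟨⟨m, hm.1⟩, fun h' => absurd h h'.not_gt, fun _ => rfl⟩
  have hr : ∀ x, ∃ r : E, (x ≤ M → IsLeast (E ∩ Ici x) r) ∧ (M < x → (r : K) = M) := fun x => by
    rcases le_or_gt x M with h | h
    · obtain ⟨l, hl⟩ := hE.exists_isLeast_inter_Ici hM.1 h
      exact ⟨⟨l, hl.1.1⟩, fun _ => hl, fun h' => absurd h h'.not_ge⟩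
    · exact ⟨⟨M, hM.1⟩, fun h' => absurd h h'.not_gt, fun _ => rfl⟩
  choose l hl using hl
  choose r hr using hr
  -- Urysohn functions serve as interpolation weights across the gaps. They are chosen per pair of
  -- endpoints, independently of `f`, which keeps the extension linear.
  have hΛ : ∀ a b : E, ∃ φ : C(K, ℝ), (∀ x, φ x ∈ Icc (0 : ℝ) 1) ∧
      ((a : K) < b → φ a = 0 ∧ φ b = 1) := fun a b => by
    rcases lt_or_ge (a : K) b with h | h
    · obtain ⟨φ, h0, h1, hφ⟩ := exists_continuous_zero_one_of_isClosed
          (isClosed_singleton (x := (a : K)))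
        (isClosed_singleton (x := (b : K))) (by simpa using h.ne)
      exact ⟨φ, hφ, fun _ => ⟨h0 rfl, h1 rfl⟩⟩
    · exact ⟨0, fun x => by simp, fun h' => absurd h h'.not_ge⟩
  choose Λ hΛ01 hΛ using hΛ
  let s : C(E, ℝ) → K → ℝ := fun f x =>
    (1 - Λ (l x) (r x) x) * f (l x) + Λ (l x) (r x) x * f (r x)
  have hlr : ∀ {x}, l x = r x → ∀ f, s f x = f (l x) := fun {x} h f => by
    simp only [s, ← h]; ring
  have hlE : ∀ x : E, l x = x := fun x => Subtype.ext <| le_antisymm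
    ((hl x).1 (hm.2 x.2)).1.2 (((hl x).1 (hm.2 x.2)).2 ⟨x.2, le_rfl⟩)
  have hrE : ∀ x : E, r x = x := fun x => Subtype.ext <| le_antisymm
    (((hr x).1 (hM.2 x.2)).2 ⟨x.2, le_rfl⟩) ((hr x).1 (hM.2 x.2)).1.2
  have hsE : ∀ f (x : E), s f x = f x := fun f x => by
    rw [hlr ((hlE x).trans (hrE x).symm), hlE]
  have hsgap : ∀ f (a b : E), (a : K) < b → E ∩ Ioo (a : K) b = ∅ → ∀ x ∈ Icc (a : K) b,
      s f x = (1 - Λ a b x) * f a + Λ a b x * f b := by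
    intro f a b hab hemp x hx
    rcases hx.1.eq_or_lt with h | hax
    · obtain rfl := h
      rw [hsE, ((hΛ a b) hab).1]; ring
    rcases hx.2.eq_or_lt with h | hxb
    · obtain rfl := h
      rw [hsE, ((hΛ a b) hab).2]; ring
    have hxE : x ∉ E := fun h => by
      have : x ∈ E ∩ Ioo (a : K) b := ⟨h, hax, hxb⟩
      rw [hemp] at this; exact this
    have h1 := (hl x).1 ((hm.2 a.2).trans hax.le)
    have h2 := (hr x).1 (hxb.le.trans (hM.2 b.2))
    have hla : l x = a := by
      refine Subtype.ext (le_antisymm (not_lt.1 fun h => ?_) (h1.2 ⟨a.2, hax.le⟩))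
      have : (l x : K) ∈ E ∩ Ioo (a : K) b := ⟨(l x).2, h, lt_of_le_of_lt h1.1.2 hxb⟩
      rw [hemp] at this; exact this
    have hrb : r x = b := by
      refine Subtype.ext (le_antisymm (h2.2 ⟨b.2, hxb.le⟩) (not_lt.1 fun h => ?_))
      have : (r x : K) ∈ E ∩ Ioo (a : K) b := ⟨(r x).2, lt_of_lt_of_le hax h2.1.2, h⟩
      rw [hemp] at this; exact this
    simp only [s, hla, hrb]
  have hcont : ∀ f, Continuous (s f) := fun f => by
    refine continuous_of_gaps hE (m := m) (M := M) ?_ ?_ hm hM ?_ ?_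
    · rw [continuousOn_iff_continuous_domRestrict]
      convert f.continuous using 1
      ext x
      exact hsE f x
    · intro a ha b hb hab hemp
      have h := hsgap f ⟨a, ha⟩ ⟨b, hb⟩ hab hemp
      refine ⟨ContinuousOn.congr (Continuous.continuousOn (by fun_prop)) h, fun x hx => ?_⟩
      have e1 : s f a = f ⟨a, ha⟩ := hsE f ⟨a, ha⟩
      have e2 : s f b = f ⟨b, hb⟩ := hsE f ⟨b, hb⟩
      rw [h x hx, e1, e2, ← segment_eq_uIcc]
      have h01 := hΛ01 ⟨a, ha⟩ ⟨b, hb⟩ x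
      exact ⟨_, _, sub_nonneg.2 h01.2, h01.1, by ring, rfl⟩
    · intro x hx
      have h1 : l x = ⟨m, hm.1⟩ := by
        rcases hx.eq_or_lt with rfl | h
        · exact hlE ⟨x, hm.1⟩
        · exact Subtype.ext ((hl x).2 h)
      have h2 : r x = ⟨m, hm.1⟩ := by
        have := (hr x).1 (hx.trans (hm.2 hM.1))
        exact Subtype.ext (le_antisymm (this.2 ⟨hm.1, hx⟩) (hm.2 (r x).2))
      rw [hlr (h1.trans h2.symm), h1]
      exact (hsE f ⟨m, hm.1⟩).symm
    · intro x hx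
      have h1 : r x = ⟨M, hM.1⟩ := by
        rcases hx.eq_or_lt with rfl | h
        · exact hrE ⟨M, hM.1⟩
        · exact Subtype.ext ((hr x).2 h)
      have h2 : l x = ⟨M, hM.1⟩ := by
        have := (hl x).1 ((hm.2 hM.1).trans hx)
        exact Subtype.ext (le_antisymm (hM.2 (l x).2) (this.2 ⟨hM.1, hx⟩))
      rw [hlr (h2.trans h1.symm), h2]
      exact (hsE f ⟨M, hM.1⟩).symm
  let S : C(E, ℝ) →ₗ[ℝ] C(K, ℝ) :=
    { toFun := fun f => ⟨s f, hcont f⟩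
      map_add' := fun f g => by
        ext x
        simp only [s, ContinuousMap.coe_mk, ContinuousMap.add_apply]; ring
      map_smul' := fun c f => by
        ext x
        simp only [s, ContinuousMap.coe_mk, ContinuousMap.smul_apply, smul_eq_mul,
          RingHom.id_apply]; ring }
  refine ⟨S.mkContinuous 1 fun f => ?_, hsE⟩
  rw [one_mul, ContinuousMap.norm_le _ (norm_nonneg _)]
  intro x
  have h01 := hΛ01 (l x) (r x) x
  have h1 := abs_le.1 (f.norm_coe_le_norm (l x))
  have h2 := abs_le.1 (f.norm_coe_le_norm (r x))
  change |s f x| ≤ ‖f‖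
  simp only [s]
  rw [abs_le]
  constructor <;> nlinarith [h01.1, h01.2, h1.1, h1.2, h2.1, h2.2]

/-! ### Monotone maps of compact lines to the reals -/

theorem exists_monotone_continuous_separating {a b : K} (hab : a < b) :
    ∃ u : K → ℝ, Continuous u ∧ Monotone u ∧ (∀ x, u x ∈ Icc (0 : ℝ) 1) ∧ u a = 0 ∧ u b = 1 := by
  obtain ⟨f, h0, h1, hf⟩ := exists_continuous_zero_one_of_isClosed (isClosed_Iic (a := a))
    (isClosed_Ici (a := b)) (Set.Iic_disjoint_Ici.2 hab.not_ge)
  have hne : ∀ x, ((fun y => f (min y x)) '' univ).Nonempty := fun x => ⟨_, a, trivial, rfl⟩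
  have hbdd : ∀ x, BddAbove ((fun y => f (min y x)) '' univ) := fun x =>
    ⟨1, by rintro _ ⟨y, -, rfl⟩; exact (hf _).2⟩
  have hle : ∀ x y, f (min y x) ≤ sSup ((fun y => f (min y x)) '' univ) := fun x y =>
    le_csSup (hbdd x) ⟨y, trivial, rfl⟩
  have h01 : ∀ x, sSup ((fun y => f (min y x)) '' univ) ∈ Icc (0 : ℝ) 1 := fun x =>
    ⟨(hf _).1.trans (hle x a), csSup_le (hne x) (by rintro _ ⟨y, -, rfl⟩; exact (hf _).2)⟩
  -- This is the running supremum of `f` over the points up to `x`; the form `f (min y x)` has an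
  -- index set independent of `x`, so compactness gives continuity.
  refine ⟨fun x => sSup ((fun y => f (min y x)) '' univ), ?_, ?_, h01, ?_, ?_⟩
  · refine IsCompact.continuous_sSup (f := fun x y => f (min y x)) isCompact_univ ?_
    exact f.continuous.comp (continuous_snd.min continuous_fst)
  · intro x x' hx
    refine csSup_le (hne x) ?_
    rintro _ ⟨y, -, rfl⟩
    have : min y x = min (min y x) x' := (min_eq_left ((min_le_right _ _).trans hx)).symm
    change f (min y x) ≤ _
    rw [this]
    exact hle x' _
  · refine le_antisymm (csSup_le (hne a) ?_) (h01 a).1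
    rintro _ ⟨y, -, rfl⟩
    exact (h0 (min_le_right y a)).le
  · refine le_antisymm (h01 b).2 ?_
    have := hle b b
    rwa [min_self, h1 (self_mem_Ici (a := b))] at this

end CompactLine

/-- A sum with positive summable weights converges uniformly and retains every strict increase of a
single term. -/
theorem exists_monotone_continuous_sum {X ι : Type*} [TopologicalSpace X] [Preorder X]
    [Countable ι] (u : ι → X → ℝ) (hc : ∀ i, Continuous (u i)) (hm : ∀ i, Monotone (u i))
    (h01 : ∀ i x, u i x ∈ Icc (0 : ℝ) 1) :
    ∃ q : X → ℝ, Continuous q ∧ Monotone q ∧ (∀ x, q x ∈ Icc (0 : ℝ) 1) ∧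
      (∀ x y, x ≤ y → ∀ i, u i x < u i y → q x < q y) ∧
      ∀ x y, (∀ i, u i x = u i y) → q x = q y := by
  have := Encodable.ofCountable ι
  obtain ⟨w, hw, c, hwc, hc1⟩ := posSumOfEncodable one_pos ι
  have hs : ∀ x, Summable fun i => w i * u i x := fun x =>
    Summable.of_nonneg_of_le (fun i => mul_nonneg (hw i).le (h01 i x).1)
      (fun i => mul_le_of_le_one_right (hw i).le (h01 i x).2) hwc.summable
  refine ⟨fun x => ∑' i, w i * u i x, ?_, ?_, ?_, ?_, ?_⟩
  · refine continuous_tsum (fun i => (hc i).const_mul _) hwc.summable fun i x => ?_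
    rw [Real.norm_of_nonneg (mul_nonneg (hw i).le (h01 i x).1)]
    exact mul_le_of_le_one_right (hw i).le (h01 i x).2
  · exact fun x y hxy => (hs x).tsum_le_tsum
      (fun i => mul_le_mul_of_nonneg_left (hm i hxy) (hw i).le) (hs y)
  · refine fun x => ⟨tsum_nonneg fun i => mul_nonneg (hw i).le (h01 i x).1, ?_⟩
    refine ((hs x).tsum_le_tsum (fun i => ?_) hwc.summable).trans (hwc.tsum_eq.le.trans hc1)
    exact mul_le_of_le_one_right (hw i).le (h01 i x).2
  · exact fun x y hxy i hi => (hs x).tsum_lt_tsum (i := i)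
      (fun i => mul_le_mul_of_nonneg_left (hm i hxy) (hw i).le)
      (mul_lt_mul_of_pos_left hi (hw i)) (hs y)
  · exact fun x y h => by simp [h]

/-- A separable compact line maps to the unit interval by a monotone continuous map that only
glues jumps, and none of the jumps meeting a prescribed countable set. -/
theorem exists_monotone_continuous_gluing_jumps {K : Type*} [LinearOrder K] [TopologicalSpace K]
    [OrderTopology K] [CompactSpace K] [SeparableSpace K] {C : Set K} (hC : C.Countable) :
    ∃ q : K → ℝ, Continuous q ∧ Monotone q ∧ (∀ x, q x ∈ Icc (0 : ℝ) 1) ∧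
      ∀ x y, x < y → q x = q y → x ⋖ y ∧ x ∉ C ∧ y ∉ C := by
  obtain ⟨D₀, hD₀, hdense⟩ := exists_countable_dense K
  let D : Set K := D₀ ∪ C
  have hD : D.Countable := hD₀.union hC
  -- Neighbours are adjoined so that a jump meeting `D` has both ends in `D'` and is therefore
  -- separated by some `u i`.
  let D' : Set K := D ∪ ⋃ d ∈ D, ({x | x ⋖ d} ∪ {x | d ⋖ x})
  have hD' : D'.Countable := hD.union <| hD.biUnion fun d _ =>
    Countable.union (Subsingleton.countable fun x hx y hy => CovBy.unique_left hx hy)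
      (Subsingleton.countable fun x hx y hy => CovBy.unique_right hx hy)
  have hpred : ∀ x d, d ∈ D → x ⋖ d → x ∈ D' := fun x d hd h =>
    Or.inr (mem_biUnion hd (Or.inl h))
  have hsucc : ∀ x d, d ∈ D → d ⋖ x → x ∈ D' := fun x d hd h =>
    Or.inr (mem_biUnion hd (Or.inr h))
  have := hD'.to_subtype
  let ι := {p : D' × D' // (p.1 : K) < p.2}
  choose u hu using fun i : ι => exists_monotone_continuous_separating i.2
  obtain ⟨q, hqc, hqm, hq01, hlt, -⟩ := exists_monotone_continuous_sum u (fun i => (hu i).1)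
    (fun i => (hu i).2.1) (fun i => (hu i).2.2.1)
  have hsep : ∀ x d d' y, x ≤ d → d < d' → d' ≤ y → d ∈ D' → d' ∈ D' → q x < q y := by
    intro x d d' y hxd hdd hdy hd hd'
    refine (hqm hxd).trans_lt (lt_of_lt_of_le ?_ (hqm hdy))
    refine hlt d d' hdd.le ⟨(⟨d, hd⟩, ⟨d', hd'⟩), hdd⟩ ?_
    rw [(hu _).2.2.2.1, (hu _).2.2.2.2]
    exact one_pos
  refine ⟨q, hqc, hqm, hq01, fun x y hxy hq => ?_⟩
  have hcov : x ⋖ y := by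
    refine ⟨hxy, fun z hxz hzy => ?_⟩
    obtain ⟨d, hd, hdD⟩ := hdense.inter_open_nonempty (Ioo x y) isOpen_Ioo ⟨z, hxz, hzy⟩
    have hdD' : d ∈ D := Or.inl hdD
    -- A point of `D₀` in `Ioo x d` would be separated from `d`. By density that interval is empty,
    -- so `x` is a neighbour of `d`, lies in `D'`, and is itself separated from `d`.
    have key : ∀ e ∈ D₀, e ∉ Ioo x d := fun e he h =>
      (hsep x e d y h.1.le h.2 hd.2.le (Or.inl (Or.inl he)) (Or.inl hdD')).ne hq
    have hemp : x ⋖ d := by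
      refine ⟨hd.1, fun w h1 h2 => ?_⟩
      obtain ⟨e, he, heD⟩ := hdense.inter_open_nonempty (Ioo x d) isOpen_Ioo ⟨w, h1, h2⟩
      exact key e heD he
    exact (hsep x x d y le_rfl hd.1 hd.2.le (hpred x d hdD' hemp) (Or.inl hdD')).ne hq
  refine ⟨hcov, fun hx => ?_, fun hy => ?_⟩
  · exact (hsep x x y y le_rfl hxy le_rfl (Or.inl (Or.inr hx)) (hsucc y x (Or.inr hx) hcov)).ne hq
  · exact (hsep x x y y le_rfl hxy le_rfl (hpred x y (Or.inr hy) hcov) (Or.inl (Or.inr hy))).ne hq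

/-! ### Functions vanishing on a closed subset -/

/-- Restriction of continuous functions to a subset. -/
def restrictCLM {K : Type*} [TopologicalSpace K] (E : Set K) : C(K, ℝ) →L[ℝ] C(E, ℝ) :=
  precompCLM ℝ ⟨Subtype.val, continuous_subtype_val⟩

@[simp] theorem restrictCLM_apply {K : Type*} [TopologicalSpace K] (E : Set K) (f : C(K, ℝ))
    (x : E) : restrictCLM E f x = f x := rfl

/-- If all but countably many jumps of a separable compact line have both ends in a closed set `E`,
then the functions vanishing on `E` form a complemented subspace of `C[0, 1]`. -/
theorem embedsComplemented_ker_restrict {K : Type*} [LinearOrder K] [TopologicalSpace K]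
    [OrderTopology K] [CompactSpace K] [SeparableSpace K] {E : Set K} (hE : IsClosed E)
    (hne : E.Nonempty)
    (hJ : {x | ∃ y, (x ⋖ y ∨ y ⋖ x) ∧ ¬ (x ∈ E ∧ y ∈ E)}.Countable) :
    EmbedsComplemented (restrictCLM E).ker C(Icc (0 : ℝ) 1, ℝ) := by
  obtain ⟨q, hqc, hqm, hq01, hq⟩ := exists_monotone_continuous_gluing_jumps hJ
  let Q : C(K, Icc (0 : ℝ) 1) := ⟨fun x => ⟨q x, hq01 x⟩, by fun_prop⟩
  have hQq : ∀ {x y}, Q x = Q y → q x = q y := fun h => congrArg Subtype.val h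
  -- Jumps glued by `q` avoid the exceptional set, so both their ends lie in `E`, where `f`
  -- vanishes.
  have hglue : ∀ f : (restrictCLM E).ker, ∀ x y, Q x = Q y → (f : C(K, ℝ)) x = (f : C(K, ℝ)) y := by
    intro f
    have h0 : ∀ x ∈ E, (f : C(K, ℝ)) x = 0 := fun x hx =>
      congrArg (fun g : C(E, ℝ) => g ⟨x, hx⟩) f.2
    have key : ∀ x y, x < y → Q x = Q y → (f : C(K, ℝ)) x = (f : C(K, ℝ)) y := by
      intro x y hxy h
      obtain ⟨hcov, hx, -⟩ := hq x y hxy (hQq h)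
      have hxyE : x ∈ E ∧ y ∈ E := by
        by_contra hnot
        exact hx ⟨y, Or.inl hcov, hnot⟩
      rw [h0 x hxyE.1, h0 y hxyE.2]
    intro x y h
    rcases lt_trichotomy x y with hxy | rfl | hxy
    · exact key x y hxy h
    · rfl
    · exact (key y x hxy h.symm).symm
  let Q' : C(K, range Q) := ⟨fun x => ⟨Q x, mem_range_self x⟩, by fun_prop⟩
  have hQ's : Function.Surjective Q' := by
    rintro ⟨_, x, rfl⟩
    exact ⟨x, rfl⟩
  have hquot : IsQuotientMap Q' := Q'.continuous.isClosedMap.isQuotientMap Q'.continuous hQ's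
  choose σ hσ using hQ's
  have hfσ : ∀ (f : (restrictCLM E).ker) x, (f : C(K, ℝ)) (σ (Q' x)) = (f : C(K, ℝ)) x := fun f x =>
    hglue f _ _ (congrArg Subtype.val (hσ (Q' x)))
  have hF : IsClosed (range Q) := (isCompact_range Q.continuous).isClosed
  have : CompactSpace (range Q) := isCompact_iff_compactSpace.1 (isCompact_range Q.continuous)
  let lift₀ : (restrictCLM E).ker →ₗ[ℝ] C(range Q, ℝ) :=
    { toFun := fun f => ⟨fun t => (f : C(K, ℝ)) (σ t), hquot.continuous_iff.2
        ((f : C(K, ℝ)).continuous.congr fun x => (hfσ f x).symm)⟩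
      map_add' := fun f g => rfl
      map_smul' := fun c f => rfl }
  let lift : (restrictCLM E).ker →L[ℝ] C(range Q, ℝ) := lift₀.mkContinuous 1 fun f => by
    rw [one_mul, ContinuousMap.norm_le _ (norm_nonneg _)]
    exact fun t => (f : C(K, ℝ)).norm_coe_le_norm _
  have hlift : ∀ f x, lift f (Q' x) = (f : C(K, ℝ)) x := hfσ
  have hE' : IsClosed (Q '' E) := (hE.isCompact.image Q.continuous).isClosed
  obtain ⟨x₀, hx₀⟩ := hne
  obtain ⟨SF, hSF⟩ := exists_extension_operator hF ⟨Q x₀, x₀, rfl⟩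
  obtain ⟨SE, hSE⟩ := exists_extension_operator hE' ⟨Q x₀, x₀, hx₀, rfl⟩
  -- Subtracting the extension of `h` from `Q '' E` forces the result to vanish on `E`, and changes
  -- nothing if `h` already vanishes on `Q '' E`.
  let r₀ : C(Icc (0 : ℝ) 1, ℝ) →L[ℝ] C(K, ℝ) :=
    (precompCLM ℝ Q).comp (ContinuousLinearMap.id ℝ _ - SE.comp (restrictCLM (Q '' E)))
  have hr₀ : ∀ h x, r₀ h x = h (Q x) - SE (restrictCLM (Q '' E) h) (Q x) := fun h x => rfl
  refine ⟨SF.comp lift, r₀.codRestrict _ fun h => ?_, fun f => ?_⟩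
  · rw [LinearMap.mem_ker]
    ext x
    have := hSE (restrictCLM (Q '' E) h) ⟨Q x, x, x.2, rfl⟩
    change r₀ h x = 0
    rw [hr₀, this]
    simp
  · refine Subtype.ext ?_
    ext x
    have hSFx : ∀ x, SF (lift f) (Q x) = (f : C(K, ℝ)) x := fun x =>
      (hSF (lift f) (Q' x)).trans (hlift f x)
    have h0 : restrictCLM (Q '' E) (SF (lift f)) = 0 := by
      ext ⟨_, y, hy, rfl⟩
      rw [restrictCLM_apply, hSFx]
      exact congrArg (fun g : C(E, ℝ) => g ⟨y, hy⟩) f.2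
    change r₀ (SF (lift f)) x = _
    rw [hr₀, h0, map_zero, hSFx]
    simp

/-! ### The order and topology of split lines -/

namespace SplitLine

variable {K A : Set ℝ}

/-- The point `(x, 0)`. -/
def lower (x : ℝ) (hx : x ∈ K) : SplitLine K A := ⟨toLex (x, 0), Or.inl ⟨hx, rfl⟩⟩

/-- The point `(a, 1)`. -/
def upper (a : ℝ) (ha : a ∈ A) : SplitLine K A := ⟨toLex (a, 1), Or.inr ⟨ha, rfl⟩⟩

theorem eq_lower_or_upper (p : SplitLine K A) :
    (∃ x hx, p = lower x hx) ∨ ∃ a ha, p = upper a ha := by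
  obtain ⟨p, ⟨h1, h2⟩ | ⟨h1, h2⟩⟩ := p
  · exact Or.inl ⟨_, h1, Subtype.ext (congrArg toLex (Prod.ext rfl h2))⟩
  · exact Or.inr ⟨_, h1, Subtype.ext (congrArg toLex (Prod.ext rfl h2))⟩

@[simp] theorem lower_lt_lower {x y : ℝ} {hx : x ∈ K} {hy : y ∈ K} :
    (lower x hx : SplitLine K A) < lower y hy ↔ x < y := by
  change (toLex (x, (0 : Fin 2)) : ℝ ×ₗ Fin 2) < toLex (y, 0) ↔ _
  simp [Prod.Lex.lt_iff]

@[simp] theorem upper_lt_upper {x y : ℝ} {hx : x ∈ A} {hy : y ∈ A} :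
    (upper x hx : SplitLine K A) < upper y hy ↔ x < y := by
  change (toLex (x, (1 : Fin 2)) : ℝ ×ₗ Fin 2) < toLex (y, 1) ↔ _
  simp [Prod.Lex.lt_iff]

@[simp] theorem upper_lt_lower {x y : ℝ} {hx : x ∈ A} {hy : y ∈ K} :
    (upper x hx : SplitLine K A) < lower y hy ↔ x < y := by
  change (toLex (x, (1 : Fin 2)) : ℝ ×ₗ Fin 2) < toLex (y, 0) ↔ _
  simp [Prod.Lex.lt_iff]

@[simp] theorem lower_lt_upper {x y : ℝ} {hx : x ∈ K} {hy : y ∈ A} :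
    (lower x hx : SplitLine K A) < upper y hy ↔ x ≤ y := by
  change (toLex (x, (0 : Fin 2)) : ℝ ×ₗ Fin 2) < toLex (y, 1) ↔ _
  simp [Prod.Lex.lt_iff, le_iff_lt_or_eq]

/-- The first coordinate. -/
def proj (hA : A ⊆ K) (p : SplitLine K A) : K :=
  ⟨(ofLex p.1).1, p.2.elim (fun h => h.1) (fun h => hA h.1)⟩

@[simp] theorem proj_lower (hA : A ⊆ K) (x : ℝ) (hx : x ∈ K) :
    proj hA (lower x hx) = ⟨x, hx⟩ := rfl

@[simp] theorem proj_upper (hA : A ⊆ K) (x : ℝ) (hx : x ∈ A) :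
    proj hA (upper x hx) = ⟨x, hA hx⟩ := rfl

theorem continuous_proj [OrderTopology K] (hA : A ⊆ K) : Continuous (proj hA) := by
  rw [OrderTopology.continuous_iff]
  rintro ⟨t, ht⟩
  constructor
  · by_cases htA : t ∈ A
    · convert isOpen_Ioi (a := (upper t htA : SplitLine K A)) using 1
      ext p
      obtain ⟨x, hx, rfl⟩ | ⟨x, hx, rfl⟩ := p.eq_lower_or_upper <;> simp
    · convert isOpen_Ioi (a := (lower t ht : SplitLine K A)) using 1
      ext p
      obtain ⟨x, hx, rfl⟩ | ⟨x, hx, rfl⟩ := p.eq_lower_or_upper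
      · simp
      · have : t ≠ x := fun h => htA (h ▸ hx)
        simp [le_iff_lt_or_eq, this]
  · convert isOpen_Iio (a := (lower t ht : SplitLine K A)) using 1
    ext p
    obtain ⟨x, hx, rfl⟩ | ⟨x, hx, rfl⟩ := p.eq_lower_or_upper <;> simp

end SplitLine

/-! ### Cantor space inside the split interval -/

namespace SplitUnitInterval

open SplitLine

variable {B : Set ℝ}

/-- The map `x ↦ (x, 0)`. -/
def lowerMap (B : Set ℝ) (x : Icc (0 : ℝ) 1) : SplitUnitInterval B := lower x x.2

theorem continuousWithinAt_Iic_lowerMap (x : Icc (0 : ℝ) 1) :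
    ContinuousWithinAt (lowerMap B) (Iic x) x := by
  refine tendsto_order.2 ⟨fun p hp => ?_, fun p hp => ?_⟩
  · have hpx : ∀ᶠ y : Icc (0 : ℝ) 1 in 𝓝 x, p < lowerMap B y := by
      obtain ⟨z, hz, rfl⟩ | ⟨z, hz, rfl⟩ := p.eq_lower_or_upper
      · have hzx : z < x := lower_lt_lower.1 hp
        filter_upwards [continuous_subtype_val.continuousAt.eventually (lt_mem_nhds hzx)] with y hy
        exact lower_lt_lower.2 hy
      · have hzx : z < x := upper_lt_lower.1 hp
        filter_upwards [continuous_subtype_val.continuousAt.eventually (lt_mem_nhds hzx)] with y hy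
        exact upper_lt_lower.2 hy
    exact nhdsWithin_le_nhds hpx
  · filter_upwards [self_mem_nhdsWithin] with y hy
    refine lt_of_le_of_lt ?_ hp
    exact not_lt.1 fun h => (lower_lt_lower.1 h).not_ge hy

/-- The right-hand limit of `lowerMap B` at `x` is `(x, 1)` when `x ∈ B` and `(x, 0)` otherwise, so
the only obstruction is a difference of the values of `f` on a split pair. -/
theorem continuousWithinAt_Ioi_comp_lowerMap {Y : Type*} [TopologicalSpace Y]
    {f : SplitUnitInterval B → Y} (hf : Continuous f)
    (x : Icc (0 : ℝ) 1) (hx : ∀ h : (x : ℝ) ∈ B, f (upper x h) = f (lower x x.2)) :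
    ContinuousWithinAt (f ∘ lowerMap B) (Ioi x) x := by
  let p : SplitUnitInterval B := by
    classical exact if h : (x : ℝ) ∈ B then upper x h else lower x x.2
  have hfp : f p = f (lowerMap B x) := by
    by_cases h : (x : ℝ) ∈ B
    · simp only [p, h, dif_pos]; exact hx h
    · simp only [p, h, dif_neg, not_false_eq_true]; rfl
  have hp : Tendsto (lowerMap B) (𝓝[>] x) (𝓝 p) := by
    refine tendsto_order.2 ⟨fun r hr => ?_, fun r hr => ?_⟩
    · filter_upwards [self_mem_nhdsWithin] with y hy
      have hy : (x : ℝ) < y := hy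
      refine hr.trans ?_
      by_cases h : (x : ℝ) ∈ B
      · simp only [p, h, dif_pos]; exact upper_lt_lower.2 hy
      · simp only [p, h, dif_neg, not_false_eq_true]; exact lower_lt_lower.2 hy
    · have key : ∃ z : ℝ, (x : ℝ) < z ∧ ∀ y : Icc (0 : ℝ) 1, (y : ℝ) < z → lowerMap B y < r := by
        obtain ⟨z, hz, rfl⟩ | ⟨z, hz, rfl⟩ := r.eq_lower_or_upper
        · refine ⟨z, ?_, fun y hy => lower_lt_lower.2 hy⟩
          by_cases h : (x : ℝ) ∈ B
          · simp only [p, h, dif_pos] at hr; exact upper_lt_lower.1 hr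
          · simp only [p, h, dif_neg, not_false_eq_true] at hr; exact lower_lt_lower.1 hr
        · refine ⟨z, ?_, fun y hy => lower_lt_upper.2 hy.le⟩
          by_cases h : (x : ℝ) ∈ B
          · simp only [p, h, dif_pos] at hr; exact upper_lt_upper.1 hr
          · simp only [p, h, dif_neg, not_false_eq_true] at hr
            exact lt_of_le_of_ne (lower_lt_upper.1 hr) fun he => h (he ▸ hz)
      obtain ⟨z, hz, hlt⟩ := key
      have : ∀ᶠ y : Icc (0 : ℝ) 1 in 𝓝 x, lowerMap B y < r := by
        filter_upwards [continuous_subtype_val.continuousAt.eventually (gt_mem_nhds hz)] with y hy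
        exact hlt y hy
      exact nhdsWithin_le_nhds this
  have := (hf.tendsto p).comp hp
  rwa [hfp] at this

/-- A discontinuity is a jump of `f` between `(x, 0)` and `(x, 1)`, across some rational level `r`.
After an upward jump `f` stays above `r` on an interval to the right, which can contain no other
upward jump across `r`; disjoint intervals are countably many. Downward jumps are those of `-f`. -/
theorem countable_setOf_not_continuousAt_comp_lowerMap (hB : B ⊆ Ioo 0 1)
    {f : SplitUnitInterval B → ℝ} (hf : Continuous f) :
    {x | ¬ ContinuousAt (f ∘ lowerMap B) x}.Countable := by
  have hB' : B ⊆ Icc 0 1 := hB.trans Ioo_subset_Icc_self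
  -- upward jumps across a fixed level
  have key : ∀ {f : SplitUnitInterval B → ℝ}, Continuous f → ∀ r : ℝ,
      {x : Icc (0 : ℝ) 1 | ∃ h : (x : ℝ) ∈ B, f (lower x x.2) < r ∧ r < f (upper x h)}.Countable :=
      by
    intro f hf r
    have hu : ∀ x : Icc (0 : ℝ) 1,
        (∃ h : (x : ℝ) ∈ B, f (lower x x.2) < r ∧ r < f (upper x h)) →
        ∃ u : Icc (0 : ℝ) 1, x < u ∧ ∀ y ∈ Ioo x u, r < f (lower y y.2) := by
      rintro x ⟨h, -, hr⟩
      have h1 : (upper x h : SplitUnitInterval B) < lower 1 (by simp) :=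
        upper_lt_lower.2 (hB h).2
      obtain ⟨p, hp, hsub⟩ := exists_Ico_subset_of_mem_nhds
        (hf.continuousAt.eventually (lt_mem_nhds hr)) ⟨_, h1⟩
      refine ⟨proj hB' p, ?_, fun y hy => hsub ⟨(upper_lt_lower.2 hy.1).le, ?_⟩⟩
      · obtain ⟨z, hz, rfl⟩ | ⟨z, hz, rfl⟩ := p.eq_lower_or_upper
        · exact upper_lt_lower.1 hp
        · exact upper_lt_upper.1 hp
      · obtain ⟨z, hz, rfl⟩ | ⟨z, hz, rfl⟩ := p.eq_lower_or_upper
        · exact lower_lt_lower.2 hy.2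
        · exact lower_lt_upper.2 (le_of_lt hy.2)
    choose! u hu using hu
    refine PairwiseDisjoint.countable_of_Ioo (y := u) ?_ fun x hx => (hu x hx).1
    have hlt : ∀ x ∈ {x : Icc (0 : ℝ) 1 | ∃ h : (x : ℝ) ∈ B,
        f (lower x x.2) < r ∧ r < f (upper x h)}, ∀ y ∈ {x : Icc (0 : ℝ) 1 | ∃ h : (x : ℝ) ∈ B,
        f (lower x x.2) < r ∧ r < f (upper x h)}, x < y → Disjoint (Ioo x (u x)) (Ioo y (u y)) := by
      intro x hx y hy hxy
      rw [Set.disjoint_left]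
      intro z hz hz'
      have := (hu x hx).2 y ⟨hxy, hz'.1.trans hz.2⟩
      obtain ⟨_, h, _⟩ := hy
      exact lt_asymm this h
    intro x hx y hy hxy
    rcases lt_or_gt_of_ne hxy with h | h
    · exact hlt x hx y hy h
    · exact (hlt y hy x hx h).symm
  have hcount : (⋃ r : ℚ,
      {x : Icc (0 : ℝ) 1 | ∃ h : (x : ℝ) ∈ B, f (lower x x.2) < r ∧ r < f (upper x h)} ∪
      {x : Icc (0 : ℝ) 1 | ∃ h : (x : ℝ) ∈ B, -f (lower x x.2) < r ∧ r < -f (upper x h)}).Countable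
    :=
    countable_iUnion fun r => (key hf r).union (key hf.neg r)
  refine hcount.mono fun x hx => ?_
  by_contra hnot
  simp only [mem_iUnion, mem_union, mem_ofPred_eq, not_exists, not_or, not_and] at hnot
  refine hx (continuousAt_iff_continuous_left'_right'.2
    ⟨((hf.continuousAt.comp_continuousWithinAt (continuousWithinAt_Iic_lowerMap x)).mono
      Iio_subset_Iic_self), continuousWithinAt_Ioi_comp_lowerMap hf x fun h => ?_⟩)
  rcases lt_trichotomy (f (upper x h)) (f (lower x x.2)) with h' | h' | h'
  · obtain ⟨r, h1, h2⟩ := exists_rat_btwn (neg_lt_neg h')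
    exact absurd h2 ((hnot r).2 h h1)
  · exact h'
  · obtain ⟨r, h1, h2⟩ := exists_rat_btwn h'
    exact absurd h2 ((hnot r).1 h h1)

/-- `C(Δ)` embeds complementably into `C(I_B)`: the retraction averages over
non-atomic measures carried by the fibres of a Cantor set over its factor. -/
theorem embedsComplemented_binarySeq (hB : B ⊆ Ioo 0 1) [CompactSpace (SplitUnitInterval B)] :
    EmbedsComplemented C(BinarySeq, ℝ) C(SplitUnitInterval B, ℝ) := by
  have hB' : B ⊆ Icc 0 1 := hB.trans Ioo_subset_Icc_self
  obtain ⟨h₀, -, hc₀, hi₀⟩ :=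
    (isClosed_univ (X := Icc (0 : ℝ) 1)).exists_nat_bool_injection_of_not_countable
    (fun h => by
      have := h.image Subtype.val
      rw [image_univ, Subtype.range_coe] at this
      exact Cardinal.Real.Icc_countable_iff.1 this |>.not_gt one_pos)
  let H : BinarySeq → Icc (0 : ℝ) 1 := fun d => h₀ fun n => finTwoEquiv (d n)
  have hHc : Continuous H := hc₀.comp (continuous_pi fun n =>
    continuous_of_discreteTopology.comp (continuous_apply n))
  have hHi : Function.Injective H := fun d d' h => by
    have := hi₀ h
    funext n
    exact finTwoEquiv.injective (congrFun this n)
  have hemb : IsClosedEmbedding H := hHc.isClosedEmbedding hHi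
  let hH : BinarySeq ≃ₜ range H := hemb.isEmbedding.toHomeomorph
  obtain ⟨S, hS⟩ := exists_extension_operator hemb.isClosed_range (range_nonempty H)
  let τ : C(range H, BinarySeq) := ⟨fun t => (interleave.symm (hH.symm t)).1, by fun_prop⟩
  let T : C(BinarySeq, ℝ) →L[ℝ] C(SplitUnitInterval B, ℝ) :=
    (precompCLM ℝ ⟨proj hB', continuous_proj hB'⟩).comp (S.comp (precompCLM ℝ τ))
  -- For fixed `t` this is an injective random point in the fibre of `τ` over `t`. It almost surely
  -- misses any given countable set, in particular the discontinuities of `f ∘ lowerMap B`.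
  let c : BinarySeq → ℝ → Icc (0 : ℝ) 1 := fun t θ => H (interleave (t, Real.digits θ 2))
  have hcm : ∀ t, Measurable (c t) := fun t =>
    (hHc.comp (interleave.continuous.comp (Continuous.prodMk_right t))).measurable.comp
      measurable_digits
  have hci : ∀ t, InjOn (c t) (Ico 0 1) := fun t θ hθ θ' hθ' h => by
    have := interleave.injective (hHi h)
    rw [Prod.mk.injEq] at this
    exact injOn_digits hθ hθ' this.2
  refine embedsComplemented_of_averaging unitVolume (fun t θ => lowerMap B (c t θ))
    (fun f t => ?_) (fun f t => ?_) T (fun g t => ae_of_all _ fun θ => ?_)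
  · have hm : Measurable (f ∘ lowerMap B) := measurable_of_countable_not_continuousAt
      (countable_setOf_not_continuousAt_comp_lowerMap hB f.continuous)
    exact (hm.comp (hcm t)).aestronglyMeasurable
  · have hcount := (countable_setOf_not_continuousAt_comp_lowerMap hB f.continuous)
    have hcount' : {θ | θ ∈ Ico (0 : ℝ) 1 ∧ ¬ ContinuousAt (f ∘ lowerMap B) (c t θ)}.Countable :=
      countable_of_injective_of_countable_image ((hci t).mono fun θ hθ => hθ.1)
        (hcount.mono (by rintro _ ⟨θ, hθ, rfl⟩; exact hθ.2))
    filter_upwards [ae_unitVolume_mem, ae_unitVolume_notMem_of_countable hcount'] with θ hθ hθ'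
    have h1 : ContinuousAt (f ∘ lowerMap B) (c t θ) := by
      by_contra h
      exact hθ' ⟨hθ, h⟩
    have h2 : Continuous fun t => c t θ :=
      hHc.comp (interleave.continuous.comp (Continuous.prodMk_left _))
    exact ContinuousAt.comp (f := fun t => c t θ) h1 h2.continuousAt
  · have h1 : T g (lowerMap B (c t θ)) = S (precompCLM ℝ τ g) (c t θ) := rfl
    have h2 := hS (precompCLM ℝ τ g) (hH (interleave (t, Real.digits θ 2)))
    rw [h1]
    refine h2.trans ?_
    simp [τ]

end SplitUnitInterval

/-! ### Comparing a compact line with a split interval -/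

open SplitLine in
theorem cIsomorphic_splitUnitInterval_of_closed {K : Type u} [LinearOrder K] [TopologicalSpace K]
    [OrderTopology K] [CompactSpace K] [SeparableSpace K] {E : Set K} (hE : IsClosed E)
    (hne : E.Nonempty)
    (hJ : {x | ∃ y, (x ⋖ y ∨ y ⋖ x) ∧ ¬ (x ∈ E ∧ y ∈ E)}.Countable)
    {B : Set ℝ} (hB : B ⊆ Ioo 0 1) (h : E ≃ₜ SplitUnitInterval B) :
    CIsomorphic K (SplitUnitInterval B) := by
  have : CompactSpace E := isCompact_iff_compactSpace.1 hE.isCompact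
  have : CompactSpace (SplitUnitInterval B) := h.compactSpace
  obtain ⟨S, hS⟩ := exists_extension_operator hE hne
  have hSr : Function.RightInverse S (restrictCLM E) := fun f => by
    ext x
    exact hS f x
  let e₁ := ContinuousLinearEquiv.equivOfRightInverse (restrictCLM E) S hSr
  let e₂ : C(E, ℝ) ≃L[ℝ] C(SplitUnitInterval B, ℝ) :=
    ContinuousLinearEquiv.equivOfInverse (precompCLM ℝ ⟨h.symm, h.symm.continuous⟩)
      (precompCLM ℝ ⟨h, h.continuous⟩) (fun f => by ext; simp) (fun f => by ext; simp)
  -- The kernel of restriction is complemented in `C[0,1]`, hence in `C(Δ)`, so `C(I_B)` absorbs it.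
  obtain ⟨e₃⟩ := nonempty_equiv_prod_of_binarySeq (X := (restrictCLM E).ker)
    ((embedsComplemented_ker_restrict hE hne hJ).trans embedsComplemented_unitInterval_binarySeq)
    (SplitUnitInterval.embedsComplemented_binarySeq hB)
  exact ⟨(e₁.trans (e₂.prodCongr (.refl ℝ _))).trans e₃.symm⟩

open SplitLine in
/-- A separable compact line with a monotone continuous surjection onto `[0, 1]` such that all but
countably many jumps are full fibres over points of `(0, 1)`. -/
theorem cIsomorphic_splitUnitInterval_of_fibres {K : Type u} [LinearOrder K] [TopologicalSpace K]
    [OrderTopology K] [CompactSpace K] [SeparableSpace K] {g : K → ℝ} (hgc : Continuous g)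
    (hgm : Monotone g) (hg : range g = Icc 0 1)
    (hJ : {x | ∃ y, (x ⋖ y ∨ y ⋖ x) ∧ g x = g y ∧
      (g x ∈ Ioo 0 1 → ∃ z, g z = g x ∧ z ≠ x ∧ z ≠ y)}.Countable) :
    CIsomorphic K
      (SplitUnitInterval {t | t ∈ Ioo 0 1 ∧ ∃ x y, x < y ∧ g x = t ∧ g y = t}) := by
  classical
  set B : Set ℝ := {t | t ∈ Ioo 0 1 ∧ ∃ x y, x < y ∧ g x = t ∧ g y = t} with hBdef
  have hB : B ⊆ Ioo 0 1 := fun t ht => ht.1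
  have hBI : B ⊆ Icc 0 1 := hB.trans Ioo_subset_Icc_self
  have hsurj : ∀ t ∈ Icc (0 : ℝ) 1, ∃ x, g x = t := fun t ht => by
    rwa [← hg] at ht
  have hgI : ∀ x, g x ∈ Icc (0 : ℝ) 1 := fun x => hg ▸ mem_range_self x
  have h0 : (0 : ℝ) ∈ Icc (0 : ℝ) 1 := by simp
  have h1 : (1 : ℝ) ∈ Icc (0 : ℝ) 1 := by simp
  have : Nonempty K := ⟨(hsurj 0 h0).choose⟩
  have hglt : ∀ {x y}, g x < g y → x < y := fun h => not_le.1 fun h' => (hgm h').not_gt h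
  have hcl : ∀ t, IsClosed (g ⁻¹' {t}) := fun t => isClosed_singleton.preimage hgc
  have hm : ∀ t ∈ Icc (0 : ℝ) 1, ∃ m, IsLeast (g ⁻¹' {t}) m := fun t ht =>
    (hcl t).isCompact.exists_isLeast (hsurj t ht)
  have hM : ∀ t ∈ Icc (0 : ℝ) 1, ∃ m, IsGreatest (g ⁻¹' {t}) m := fun t ht =>
    (hcl t).isCompact.exists_isGreatest (hsurj t ht)
  choose! m hm using hm
  choose! M hM using hM
  have hgm' : ∀ t ∈ Icc (0 : ℝ) 1, g (m t) = t := fun t ht => (hm t ht).1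
  have hgM' : ∀ t ∈ Icc (0 : ℝ) 1, g (M t) = t := fun t ht => (hM t ht).1
  have hmM : ∀ t ∈ B, m t < M t := by
    rintro t ⟨ht, x, y, hxy, hx, hy⟩
    have ht' := Ioo_subset_Icc_self ht
    exact ((hm t ht').2 hx).trans_lt (hxy.trans_le ((hM t ht').2 hy))
  -- `(t, 0)` goes to the bottom and `(t, 1)` to the top of the fibre over `t`. The point `0` is not
  -- split and is approached only from the right, so it must go to the top of its fibre for the
  -- range to be closed.
  let ψ : SplitUnitInterval B → K := fun p =>
    if (ofLex p.1).1 ≠ 0 ∧ (ofLex p.1).2 = 0 then m (ofLex p.1).1 else M (ofLex p.1).1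
  have hψ0 : ψ (lower 0 h0) = M 0 := if_neg fun h => h.1 rfl
  have hψl : ∀ t (ht : t ∈ Icc (0 : ℝ) 1), t ≠ 0 → ψ (lower t ht) = m t := fun t ht h =>
    if_pos ⟨h, rfl⟩
  have hψu : ∀ t (ht : t ∈ B), ψ (upper t ht) = M t := fun t ht =>
    if_neg fun h => absurd (show (1 : Fin 2) = 0 from h.2) one_ne_zero
  have hgψl : ∀ t (ht : t ∈ Icc (0 : ℝ) 1), g (ψ (lower t ht)) = t := fun t ht => by
    rcases eq_or_ne t 0 with rfl | h
    · rw [hψ0, hgM' 0 ht]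
    · rw [hψl t ht h, hgm' t ht]
  have hgψu : ∀ t (ht : t ∈ B), g (ψ (upper t ht)) = t := fun t ht => by
    rw [hψu, hgM' t (hBI ht)]
  have hψ : StrictMono ψ := by
    intro p p' hp
    obtain ⟨x, hx, rfl⟩ | ⟨x, hx, rfl⟩ := p.eq_lower_or_upper <;>
    obtain ⟨y, hy, rfl⟩ | ⟨y, hy, rfl⟩ := p'.eq_lower_or_upper
    · exact hglt (by rw [hgψl, hgψl]; exact lower_lt_lower.1 hp)
    · rcases (lower_lt_upper.1 hp).eq_or_lt with h | h
      · subst h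
        rw [hψl x hx (hB hy).1.ne', hψu x hy]
        exact hmM x hy
      · exact hglt (by rw [hgψl, hgψu]; exact h)
    · exact hglt (by rw [hgψu, hgψl]; exact upper_lt_lower.1 hp)
    · exact hglt (by rw [hgψu, hgψu]; exact upper_lt_upper.1 hp)
  have hmE : ∀ t ∈ Icc (0 : ℝ) 1, t ≠ 0 → m t ∈ range ψ := fun t ht h => ⟨_, hψl t ht h⟩
  have hME : ∀ t ∈ B, M t ∈ range ψ := fun t ht => ⟨_, hψu t ht⟩
  -- A point off the range lies below `M 0`, above `m 1`, or strictly between the ends of a fibre,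
  -- and each of these conditions defines an open set disjoint from the range.
  have hEcl : IsClosed (range ψ) := by
    rw [← isOpen_compl_iff, isOpen_iff_mem_nhds]
    intro x hx
    obtain ⟨t, ht, hxt⟩ : ∃ t, t ∈ Icc (0 : ℝ) 1 ∧ g x = t := ⟨_, hgI x, rfl⟩
    rcases eq_or_ne t 0 with rfl | ht0
    · have hne : x ≠ M 0 := fun h => hx ⟨_, hψ0.trans h.symm⟩
      filter_upwards [isOpen_Iio.mem_nhds (lt_of_le_of_ne ((hM 0 h0).2 hxt) hne)]
      rintro _ hy ⟨p, rfl⟩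
      rw [mem_Iio, ← hψ0, hψ.lt_iff_lt] at hy
      obtain ⟨z, hz, rfl⟩ | ⟨z, hz, rfl⟩ := p.eq_lower_or_upper
      · exact (lower_lt_lower.1 hy).not_ge hz.1
      · exact (upper_lt_lower.1 hy).not_gt (hB hz).1
    have hxm : m t < x :=
      lt_of_le_of_ne ((hm t ht).2 hxt) fun h => hx ⟨_, (hψl t ht ht0).trans h⟩
    rcases eq_or_ne t 1 with rfl | ht1
    · filter_upwards [isOpen_Ioi.mem_nhds hxm]
      rintro _ hy ⟨p, rfl⟩
      rw [mem_Ioi, ← hψl 1 h1 one_ne_zero, hψ.lt_iff_lt] at hy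
      obtain ⟨z, hz, rfl⟩ | ⟨z, hz, rfl⟩ := p.eq_lower_or_upper
      · exact (lower_lt_lower.1 hy).not_ge hz.2
      · exact (lower_lt_upper.1 hy).not_gt (hB hz).2
    have htB : t ∈ B :=
      ⟨⟨lt_of_le_of_ne ht.1 ht0.symm, lt_of_le_of_ne ht.2 ht1⟩, m t, x, hxm, hgm' t ht, hxt⟩
    have hxM : x < M t :=
      lt_of_le_of_ne ((hM t ht).2 hxt) fun h => hx ⟨_, (hψu t htB).trans h.symm⟩
    filter_upwards [isOpen_Ioo.mem_nhds (⟨hxm, hxM⟩ : x ∈ Ioo (m t) (M t))]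
    rintro _ hy ⟨p, rfl⟩
    rw [mem_Ioo, ← hψl t ht ht0, ← hψu t htB, hψ.lt_iff_lt, hψ.lt_iff_lt] at hy
    obtain ⟨z, hz, rfl⟩ | ⟨z, hz, rfl⟩ := p.eq_lower_or_upper
    · exact (lower_lt_lower.1 hy.1).not_ge (lower_lt_upper.1 hy.2)
    · exact (upper_lt_upper.1 hy.2).not_ge (lower_lt_upper.1 hy.1)
  have : CompactSpace (range ψ) := isCompact_iff_compactSpace.1 hEcl.isCompact
  let κ : range ψ ≃ SplitUnitInterval B := (Equiv.ofInjective ψ hψ.injective).symm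
  have hψκ : ∀ e : range ψ, ψ (κ e) = e := fun e => Equiv.apply_ofInjective_symm hψ.injective e
  have hκ : Continuous κ := by
    rw [OrderTopology.continuous_iff]
    intro p
    constructor
    · convert (isOpen_Ioi (a := ψ p)).preimage continuous_subtype_val using 1
      ext e
      rw [mem_preimage, mem_preimage, mem_Ioi, mem_Ioi, ← hψκ e, hψ.lt_iff_lt]
    · convert (isOpen_Iio (a := ψ p)).preimage continuous_subtype_val using 1
      ext e
      rw [mem_preimage, mem_preimage, mem_Iio, mem_Iio, ← hψκ e, hψ.lt_iff_lt]
  have hfib : ∀ x y, x ⋖ y → g x = g y → g x ∈ Ioo 0 1 →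
      (∀ z, g z = g x → z ≠ x → z = y) → x ∈ range ψ ∧ y ∈ range ψ := by
    intro x y hxy hgxy hx hz
    have htB : g x ∈ B := ⟨hx, x, y, hxy.lt, rfl, hgxy.symm⟩
    have hI := hgI x
    have hmx : m (g x) = x := by
      by_contra hne
      have h2 := (hm _ hI).2 (show x ∈ _ from rfl)
      rw [hz _ (hgm' _ hI) hne] at h2
      exact h2.not_gt hxy.lt
    have hMy : M (g x) = y := by
      refine hz _ (hgM' _ hI) fun h => ?_
      have h2 := (hM _ hI).2 (show y ∈ _ from hgxy.symm)
      rw [h] at h2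
      exact h2.not_gt hxy.lt
    exact ⟨hmx ▸ hmE _ hI hx.1.ne', hMy ▸ hME _ htB⟩
  -- The range of `g` is an interval, so no jump of `K` can straddle two values.
  have hgcov : ∀ x y, x ⋖ y → g x = g y := by
    intro x y hxy
    by_contra hne
    have hlt : g x < g y := lt_of_le_of_ne (hgm hxy.le) hne
    obtain ⟨z, hz⟩ := hsurj ((g x + g y) / 2)
      ⟨by linarith [(hgI x).1, (hgI y).1], by linarith [(hgI x).2, (hgI y).2]⟩
    exact hxy.2 (hglt (by rw [hz]; linarith)) (hglt (by rw [hz]; linarith))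
  refine cIsomorphic_splitUnitInterval_of_closed hEcl ⟨_, mem_range_self (lower 0 h0)⟩
    (hJ.mono ?_) hB hκ.homeoOfEquivCompactToT2
  rintro x ⟨y, hxy, hnot⟩
  rcases hxy with hxy | hxy
  · have heq := hgcov x y hxy
    refine ⟨y, Or.inl hxy, heq, fun hx => ?_⟩
    by_contra! hcon
    exact hnot (hfib x y hxy heq hx hcon)
  · have heq := hgcov y x hxy
    refine ⟨y, Or.inr hxy, heq.symm, fun hx => ?_⟩
    by_contra! hcon
    refine hnot (hfib y x hxy heq (heq ▸ hx) fun z hz hzy => ?_).symm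
    by_contra hzx
    exact hzy (hcon z (hz.trans heq) hzx)

/-! ### Condensation points and collapsing of gaps -/

/-- The condensation points of a set. -/
def condensationPoints {X : Type*} [TopologicalSpace X] (S : Set X) : Set X :=
  {t | ∀ U ∈ 𝓝 t, ¬ (S ∩ U).Countable}

theorem isClosed_condensationPoints {X : Type*} [TopologicalSpace X] (S : Set X) :
    IsClosed (condensationPoints S) := by
  rw [← isOpen_compl_iff, isOpen_iff_mem_nhds]
  intro t ht
  obtain ⟨U, hU, hc⟩ : ∃ U ∈ 𝓝 t, (S ∩ U).Countable := by
    simpa [condensationPoints] using ht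
  filter_upwards [eventually_mem_nhds_iff.2 hU] with s hs h
  exact h U hs hc

theorem countable_diff_condensationPoints {X : Type*} [TopologicalSpace X]
    [SecondCountableTopology X] (S : Set X) : (S \ condensationPoints S).Countable := by
  have h : ∀ t ∈ S \ condensationPoints S, ∃ U ∈ 𝓝 t, (S ∩ U).Countable := fun t ht => by
    simpa [condensationPoints] using ht.2
  choose! U hU hc using h
  obtain ⟨T, hTS, hT, hcov⟩ := countable_cover_nhdsWithin (f := U)
    (s := S \ condensationPoints S) fun t ht => mem_nhdsWithin_of_mem_nhds (hU t ht)
  refine (hT.biUnion fun t ht => hc t (hTS ht)).mono fun s hs => ?_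
  obtain ⟨t, ht, hst⟩ := mem_iUnion₂.1 (hcov hs)
  exact mem_biUnion ht ⟨hs.1, hst⟩

theorem condensationPoints_subset_closure {X : Type*} [TopologicalSpace X] (S : Set X) :
    condensationPoints S ⊆ closure S := fun t ht => by
  rw [mem_closure_iff_nhds]
  intro U hU
  rw [inter_comm]
  by_contra h
  rw [not_nonempty_iff_eq_empty] at h
  exact ht U hU (h ▸ countable_empty)

/-- The gaps to the right of different points are disjoint intervals. -/
theorem countable_setOf_gap_right (T : Set ℝ) :
    {s | s ∈ T ∧ ∃ u, s < u ∧ Ioo s u ∩ T = ∅}.Countable := by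
  have h : ∀ s ∈ {s | s ∈ T ∧ ∃ u, s < u ∧ Ioo s u ∩ T = ∅}, ∃ u, s < u ∧ Ioo s u ∩ T = ∅ :=
    fun s hs => hs.2
  choose! u hu hT using h
  have key : ∀ s ∈ {s | s ∈ T ∧ ∃ u, s < u ∧ Ioo s u ∩ T = ∅},
      ∀ t ∈ {s | s ∈ T ∧ ∃ u, s < u ∧ Ioo s u ∩ T = ∅}, s < t →
      Disjoint (Ioo s (u s)) (Ioo t (u t)) := by
    intro s hs t ht hst
    rw [Set.disjoint_left]
    intro z hz hz'
    have : t ∈ Ioo s (u s) ∩ T := ⟨⟨hst, hz'.1.trans hz.2⟩, ht.1⟩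
    rw [hT s hs] at this
    exact this
  refine PairwiseDisjoint.countable_of_Ioo (y := u) (fun s hs t ht hst => ?_) hu
  rcases lt_or_gt_of_ne hst with h | h
  · exact key s hs t ht h
  · exact (key t ht s hs h).symm

theorem countable_setOf_gap_left (T : Set ℝ) :
    {s | s ∈ T ∧ ∃ u, u < s ∧ Ioo u s ∩ T = ∅}.Countable := by
  refine countable_of_injective_of_countable_image (f := Neg.neg) neg_injective.injOn
    ((countable_setOf_gap_right (Neg.neg ⁻¹' T)).mono ?_)
  rintro _ ⟨s, ⟨hs, u, hu, h⟩, rfl⟩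
  refine ⟨by simpa using hs, -u, neg_lt_neg hu, ?_⟩
  rw [eq_empty_iff_forall_notMem] at h ⊢
  rintro z ⟨hz, hzT⟩
  exact h (-z) ⟨⟨by linarith [hz.2], by linarith [hz.1]⟩, hzT⟩

/-- The distribution function of an injective random variable is continuous. -/
theorem exists_distribution_function {F : Set ℝ} (hF : IsClosed F) {a b : ℝ}
    (hunc : ¬ (F ∩ Icc a b).Countable) :
    ∃ u : ℝ → ℝ, Continuous u ∧ Monotone u ∧ (∀ x, u x ∈ Icc (0 : ℝ) 1) ∧ u a = 0 ∧ u b = 1 ∧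
      ∀ x y, x < y → Ioo x y ∩ F = ∅ → u x = u y := by
  -- An uncountable closed set contains a Cantor set. Feeding it the binary digits of a uniform `θ`
  -- gives a random point `c θ` of `F ∩ Icc a b` without atoms; `u` is its distribution function.
  obtain ⟨h₀, hr, hc₀, hi₀⟩ := (hF.inter isClosed_Icc).exists_nat_bool_injection_of_not_countable
    hunc
  let c : ℝ → ℝ := fun θ => h₀ fun n => finTwoEquiv (Real.digits θ 2 n)
  have hcm : Measurable c := hc₀.measurable.comp <| measurable_pi_lambda _ fun n =>
    (measurable_of_countable _).comp ((measurable_pi_apply n).comp measurable_digits)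
  have hci : InjOn c (Ico 0 1) := fun θ hθ θ' hθ' h => injOn_digits hθ hθ' <| by
    funext n
    exact finTwoEquiv.injective (congrFun (hi₀ h) n)
  have hcF : ∀ θ, c θ ∈ F ∩ Icc a b := fun θ => hr (mem_range_self _)
  have hne : ∀ x, ∀ᵐ θ ∂unitVolume, c θ ≠ x := fun x => by
    have hsub : {θ | θ ∈ Ico (0 : ℝ) 1 ∧ c θ = x}.Countable :=
      Subsingleton.countable fun θ hθ θ' hθ' => hci hθ.1 hθ'.1 (hθ.2.trans hθ'.2.symm)
    filter_upwards [ae_unitVolume_mem, ae_unitVolume_notMem_of_countable hsub] with θ hθ h hx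
    exact h ⟨hθ, hx⟩
  let G : ℝ → ℝ → ℝ := fun x θ => if c θ ≤ x then 1 else 0
  have hGm : ∀ x, Measurable (G x) := fun x =>
    Measurable.ite (measurableSet_le hcm measurable_const) measurable_const measurable_const
  have hG01 : ∀ x θ, G x θ ∈ Icc (0 : ℝ) 1 := fun x θ => by
    simp only [G]; split_ifs <;> simp
  have hGb : ∀ x θ, ‖G x θ‖ ≤ 1 := fun x θ => by
    rw [Real.norm_of_nonneg (hG01 x θ).1]; exact (hG01 x θ).2
  have hGi : ∀ x, Integrable (G x) unitVolume := fun x =>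
    Integrable.of_bound (hGm x).aestronglyMeasurable 1 (ae_of_all _ (hGb x))
  have hle1 : ∀ x, ∫ θ, G x θ ∂unitVolume ≤ 1 := fun x => by
    have := integral_mono (hGi x) (integrable_const 1) fun θ => (hG01 x θ).2
    simpa using this
  refine ⟨fun x => ∫ θ, G x θ ∂unitVolume, ?_, ?_, ?_, ?_, ?_, ?_⟩
  · refine continuous_iff_continuousAt.2 fun x => continuousAt_of_dominated (bound := fun _ => 1)
      (Eventually.of_forall fun y => (hGm y).aestronglyMeasurable)
      (Eventually.of_forall fun y => ae_of_all _ (hGb y)) (integrable_const _) ?_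
    filter_upwards [hne x] with θ hθ
    rcases lt_or_gt_of_ne hθ with h | h
    · refine continuousAt_const.congr (f := fun _ => (1 : ℝ)) ?_
      filter_upwards [lt_mem_nhds h] with y hy
      simp [G, hy.le]
    · refine continuousAt_const.congr (f := fun _ => (0 : ℝ)) ?_
      filter_upwards [gt_mem_nhds h] with y hy
      simp [G, hy]
  · refine fun x y hxy => integral_mono (hGi x) (hGi y) fun θ => ?_
    simp only [G]
    split_ifs with h h'
    · exact le_rfl
    · exact absurd (h.trans hxy) h'
    · exact zero_le_one
    · exact le_rfl
  · exact fun x => ⟨integral_nonneg fun θ => (hG01 x θ).1, hle1 x⟩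
  · refine integral_eq_zero_of_ae ?_
    filter_upwards [hne a] with θ hθ
    have : ¬ c θ ≤ a := not_le.2 (lt_of_le_of_ne (hcF θ).2.1 hθ.symm)
    simp [G, this]
  · have : G b = fun _ => 1 := by
      funext θ
      simp [G, (hcF θ).2.2]
    simp [this]
  · intro x y hxy hemp
    refine integral_congr_ae ?_
    filter_upwards [hne y] with θ hθ
    have : c θ ≤ x ↔ c θ ≤ y := by
      refine ⟨fun h => h.trans hxy.le, fun h => ?_⟩
      by_contra hx
      have : c θ ∈ Ioo x y ∩ F := ⟨⟨not_le.1 hx, lt_of_le_of_ne h hθ⟩, (hcF θ).1⟩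
      rw [hemp] at this
      exact this
    simp [G, this]

/-- A continuous monotone function on the line that is constant exactly on the closures of the
gaps of the set of condensation points of `S`. -/
theorem exists_monotone_collapsing_gaps {S : Set ℝ} (hS01 : S ⊆ Icc 0 1) (hS : ¬ S.Countable) :
    ∃ φ : ℝ → ℝ, Continuous φ ∧ Monotone φ ∧ φ 0 = 0 ∧ φ 1 = 1 ∧
      ∀ x y, x < y → (φ x < φ y ↔ (Ioo x y ∩ condensationPoints S).Nonempty) := by
  set F := condensationPoints S with hFdef
  have hF : IsClosed F := isClosed_condensationPoints S
  have hSF : (S \ F).Countable := countable_diff_condensationPoints S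
  have hunc : ∀ a b t : ℝ, t ∈ F → a < t → t < b → ¬ (F ∩ Icc a b).Countable := by
    intro a b t ht hat htb hc
    refine ht (Ioo a b) (Ioo_mem_nhds hat htb) ((hSF.union hc).mono fun s hs => ?_)
    by_cases h : s ∈ F
    · exact Or.inr ⟨h, Ioo_subset_Icc_self hs.2⟩
    · exact Or.inl ⟨hs.1, h⟩
  -- One distribution function for each rational interval meeting `F`: countably many suffice to
  -- detect every point of `F` between `x` and `y`, and none of them grows across a gap of `F`.
  let ι := {p : ℚ × ℚ // ∃ t ∈ F, (p.1 : ℝ) < t ∧ t < p.2}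
  have hu : ∀ p : ι, ∃ u : ℝ → ℝ, Continuous u ∧ Monotone u ∧ (∀ x, u x ∈ Icc (0 : ℝ) 1) ∧
      u p.1.1 = 0 ∧ u p.1.2 = 1 ∧ ∀ x y, x < y → Ioo x y ∩ F = ∅ → u x = u y := fun p => by
    obtain ⟨t, ht, h1, h2⟩ := p.2
    exact exists_distribution_function hF (hunc _ _ t ht h1 h2)
  choose u hu using hu
  obtain ⟨φ, hφc, hφm, -, hlt, heq⟩ := exists_monotone_continuous_sum u (fun p => (hu p).1)
    (fun p => (hu p).2.1) (fun p => (hu p).2.2.1)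
  have hiff : ∀ x y, x < y → (φ x < φ y ↔ (Ioo x y ∩ F).Nonempty) := by
    intro x y hxy
    constructor
    · intro h
      by_contra hemp
      rw [not_nonempty_iff_eq_empty] at hemp
      exact h.ne (heq x y fun p => (hu p).2.2.2.2.2 x y hxy hemp)
    · rintro ⟨t, ⟨hxt, hty⟩, ht⟩
      obtain ⟨a, hxa, hat⟩ := exists_rat_btwn hxt
      obtain ⟨b, htb, hby⟩ := exists_rat_btwn hty
      refine hlt x y hxy.le ⟨(a, b), t, ht, hat, htb⟩ ?_
      have h1 := (hu ⟨(a, b), t, ht, hat, htb⟩).2.1 hxa.le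
      have h2 := (hu ⟨(a, b), t, ht, hat, htb⟩).2.1 hby.le
      rw [(hu _).2.2.2.1] at h1
      rw [(hu _).2.2.2.2.1] at h2
      linarith
  have hpos : φ 0 < φ 1 := by
    rw [hiff 0 1 one_pos]
    by_contra hemp
    rw [not_nonempty_iff_eq_empty] at hemp
    refine hS ((hSF.union (Set.Countable.insert 0 (countable_singleton 1))).mono fun s hs => ?_)
    by_cases h : s ∈ F
    · right
      by_contra hne
      rw [mem_insert_iff, mem_singleton_iff, not_or] at hne
      have : s ∈ Ioo (0 : ℝ) 1 ∩ F := ⟨⟨lt_of_le_of_ne (hS01 hs).1 (Ne.symm hne.1),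
        lt_of_le_of_ne (hS01 hs).2 hne.2⟩, h⟩
      rw [hemp] at this
      exact this
    · exact Or.inl ⟨hs, h⟩
  have hpos' : 0 < φ 1 - φ 0 := sub_pos.2 hpos
  refine ⟨fun x => (φ x - φ 0) / (φ 1 - φ 0), by fun_prop, fun x y hxy => ?_, by simp,
    div_self hpos'.ne', fun x y hxy => ?_⟩
  · exact div_le_div_of_nonneg_right (sub_le_sub_right (hφm hxy) _) hpos'.le
  · rw [div_lt_div_iff_of_pos_right hpos', sub_lt_sub_iff_right, hiff x y hxy]

/-! ### Mapping a compact line onto the unit interval -/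

section Fibres

variable {K : Type*} [LinearOrder K] {q : K → ℝ}

theorem countable_fibre (hq : ∀ x y, x < y → q x = q y → x ⋖ y) (t : ℝ) :
    (q ⁻¹' {t}).Countable := by
  rcases (q ⁻¹' {t}).eq_empty_or_nonempty with h | ⟨x, hx⟩
  · exact h ▸ countable_empty
  have hc : ({x} ∪ ({y | x ⋖ y} ∪ {y | y ⋖ x})).Countable :=
    (countable_singleton x).union <| Countable.union
      (Subsingleton.countable fun _ hy _ hz => CovBy.unique_right hy hz)
      (Subsingleton.countable fun _ hy _ hz => CovBy.unique_left hy hz)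
  refine hc.mono fun y hy => ?_
  have hxy : q x = q y := Eq.trans hx (Eq.symm hy)
  rcases lt_trichotomy x y with h | rfl | h
  · exact Or.inr (Or.inl (hq x y h hxy))
  · exact Or.inl rfl
  · exact Or.inr (Or.inr (hq y x h hxy.symm))

theorem Set.Countable.preimage_of_countable_fibre (hq : ∀ x y, x < y → q x = q y → x ⋖ y)
    {Z : Set ℝ} (hZ : Z.Countable) : (q ⁻¹' Z).Countable := by
  rw [← biUnion_preimage_singleton]
  exact hZ.biUnion fun t _ => countable_fibre hq t

theorem eq_or_eq_of_fibre (hq : ∀ x y, x < y → q x = q y → x ⋖ y) {x y z : K} (hxy : x ≠ y)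
    (h : q x = q y) (hz : q z = q x) : z = x ∨ z = y := by
  by_contra! hne
  wlog hlt : x < y generalizing x y
  · exact this hxy.symm h.symm (hz.trans h) hne.symm (lt_of_le_of_ne (not_lt.1 hlt) hxy.symm)
  rcases lt_or_gt_of_ne hne.1 with h1 | h1
  · exact (hq z y (h1.trans hlt) (hz.trans h)).2 h1 hlt
  rcases lt_or_gt_of_ne hne.2 with h2 | h2
  · exact (hq x y hlt h).2 h1 h2
  · exact (hq x z (hlt.trans h2) hz.symm).2 hlt h2

end Fibres

/-- Let `F` be the set of condensation points of `S`. Since `φ` is injective at all but countably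
many points of `F`, and `S \ F` is countable, almost every two-point fibre of `q` is a full fibre of
`φ ∘ q`. The set `S` is left free because `A` itself may be countable. -/
theorem exists_cIsomorphic_of_uncountable {K : Type u} [LinearOrder K] [TopologicalSpace K]
    [OrderTopology K] [CompactSpace K] [SeparableSpace K] {q : K → ℝ} (hqc : Continuous q)
    (hqm : Monotone q) (hq01 : ∀ x, q x ∈ Icc (0 : ℝ) 1)
    (hq : ∀ x y, x < y → q x = q y → x ⋖ y) {A S : Set ℝ}
    (hA : A = {t | ∃ x y, x < y ∧ q x = t ∧ q y = t}) (hAS : A ⊆ S) (hSq : S ⊆ range q)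
    (hS : ¬ S.Countable) :
    ∃ B ⊆ Ioo (0 : ℝ) 1, CIsomorphic K (SplitUnitInterval B) ∧
      (S ⊆ A → ∀ V : Set ℝ, IsOpen V → (V ∩ Ioo 0 1).Nonempty → ¬ (B ∩ V).Countable) ∧
      ∃ (φ : ℝ → ℝ) (C : Set ℝ), C.Countable ∧ B ⊆ φ '' A ∪ C := by
  have hq' : range q ⊆ Icc 0 1 := range_subset_iff.2 hq01
  obtain ⟨φ, hφc, hφm, hφ0, hφ1, hφ⟩ := exists_monotone_collapsing_gaps (hSq.trans hq') hS
  set F := condensationPoints S with hFdef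
  have hFcl : IsClosed F := isClosed_condensationPoints S
  have hSF : (S \ F).Countable := countable_diff_condensationPoints S
  have hFq : F ⊆ range q := (condensationPoints_subset_closure S).trans
    (closure_minimal hSq (isCompact_range hqc).isClosed)
  have hFI : F ⊆ Icc 0 1 := hFq.trans hq'
  have hFc : IsCompact F := isCompact_Icc.of_isClosed_subset hFcl hFI
  have hFne : F.Nonempty := by
    by_contra h
    rw [not_nonempty_iff_eq_empty] at h
    rw [h, sdiff_empty] at hSF
    exact hS hSF
  have hconst : ∀ x y, x ≤ y → Ioo x y ∩ F = ∅ → φ x = φ y := by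
    intro x y hxy h
    rcases hxy.eq_or_lt with rfl | hlt
    · rfl
    refine (hφm hxy).antisymm (not_lt.1 fun hl => ?_)
    rw [hφ x y hlt, h] at hl
    exact not_nonempty_empty hl
  have hempty : ∀ x y, x < y → φ x = φ y → Ioo x y ∩ F = ∅ := by
    intro x y hxy h
    by_contra hne
    exact ((hφ x y hxy).2 (nonempty_iff_ne_empty.2 hne)).ne h
  have hsurj : ∀ s ∈ Icc (0 : ℝ) 1, ∃ t ∈ F, φ t = s := by
    intro s hs
    obtain ⟨t, -, rfl⟩ : s ∈ φ '' Icc 0 1 := by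
      have := intermediate_value_Icc zero_le_one hφc.continuousOn
      rw [hφ0, hφ1] at this
      exact this hs
    rcases (F ∩ Iic t).eq_empty_or_nonempty with h | h
    · obtain ⟨m, hm⟩ := hFc.exists_isLeast hFne
      have htm : t ≤ m := by
        by_contra hlt
        have : m ∈ F ∩ Iic t := ⟨hm.1, (not_le.1 hlt).le⟩
        rw [h] at this
        exact this
      refine ⟨m, hm.1, (hconst t m htm ?_).symm⟩
      rw [eq_empty_iff_forall_notMem]
      exact fun z hz => (hm.2 hz.2).not_gt hz.1.2
    · obtain ⟨m, hm⟩ := (hFc.inter_right isClosed_Iic).exists_isGreatest h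
      refine ⟨m, hm.1.1, hconst m t hm.1.2 ?_⟩
      rw [eq_empty_iff_forall_notMem]
      exact fun z hz => (hm.2 ⟨hz.2, hz.1.2.le⟩).not_gt hz.1.1
  let N : Set ℝ := {s | s ∈ F ∧ ∃ u, s < u ∧ Ioo s u ∩ F = ∅} ∪
    {s | s ∈ F ∧ ∃ u, u < s ∧ Ioo u s ∩ F = ∅}
  have hN : N.Countable := (countable_setOf_gap_right F).union (countable_setOf_gap_left F)
  have hinj : ∀ s ∈ F, s ∉ N → ∀ t, φ t = φ s → t = s := by
    intro s hs hsN t hts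
    rcases lt_trichotomy t s with h | h | h
    · exact absurd (Or.inr ⟨hs, t, h, hempty t s h hts⟩) hsN
    · exact h
    · exact absurd (Or.inl ⟨hs, t, h, hempty s t h hts.symm⟩) hsN
  let P : Set ℝ := {s | s ∈ range q ∧ ∃ u, s < u ∧ Ioo s u ∩ range q = ∅} ∪
    {s | s ∈ range q ∧ ∃ u, u < s ∧ Ioo u s ∩ range q = ∅}
  have hP : P.Countable :=
    (countable_setOf_gap_right (range q)).union (countable_setOf_gap_left (range q))
  have hPcov : ∀ x y, x ⋖ y → q x ≠ q y → q x ∈ P ∧ q y ∈ P := by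
    intro x y hxy hne
    have hlt : q x < q y := lt_of_le_of_ne (hqm hxy.le) hne
    have hemp : Ioo (q x) (q y) ∩ range q = ∅ := by
      rw [eq_empty_iff_forall_notMem]
      rintro _ ⟨⟨h1, h2⟩, z, rfl⟩
      exact hxy.2 (not_le.1 fun h => (hqm h).not_gt h1) (not_le.1 fun h => (hqm h).not_gt h2)
    exact ⟨Or.inl ⟨mem_range_self x, _, hlt, hemp⟩, Or.inr ⟨mem_range_self y, _, hlt, hemp⟩⟩
  have hgm : Monotone (φ ∘ q) := hφm.comp hqm
  have hg : range (φ ∘ q) = Icc 0 1 := by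
    apply Subset.antisymm
    · rintro _ ⟨x, rfl⟩
      exact ⟨hφ0 ▸ hφm (hq01 x).1, hφ1 ▸ hφm (hq01 x).2⟩
    · intro s hs
      obtain ⟨t, ht, rfl⟩ := hsurj s hs
      obtain ⟨x, rfl⟩ := hFq ht
      exact ⟨x, rfl⟩
  -- All exceptional values of `q`: points of `S` outside `F`, gap ends of `F` where `φ` may fail to
  -- be injective, gap ends of `range q`, and the two endpoints.
  let Z : Set ℝ := ((S \ F) ∪ N) ∪ (P ∪ {0, 1})
  have hZ : Z.Countable := (hSF.union hN).union
    (hP.union (Set.Countable.insert 0 (countable_singleton 1)))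
  have hJ : {x | ∃ y, (x ⋖ y ∨ y ⋖ x) ∧ (φ ∘ q) x = (φ ∘ q) y ∧
      ((φ ∘ q) x ∈ Ioo 0 1 → ∃ z, (φ ∘ q) z = (φ ∘ q) x ∧ z ≠ x ∧ z ≠ y)}.Countable := by
    refine (hZ.preimage_of_countable_fibre hq).mono ?_
    rintro x ⟨y, hxy, -, hz⟩
    by_cases hqxy : q x = q y
    · have hne : x ≠ y := by
        rcases hxy with h | h
        · exact h.lt.ne
        · exact h.lt.ne'
      have hxA : q x ∈ A := by
        rw [hA]
        rcases hxy with h | h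
        · exact ⟨x, y, h.lt, rfl, hqxy.symm⟩
        · exact ⟨y, x, h.lt, hqxy.symm, rfl⟩
      by_cases hxF : q x ∈ F
      swap
      · exact Or.inl (Or.inl ⟨hAS hxA, hxF⟩)
      by_cases hxN : q x ∈ N
      · exact Or.inl (Or.inr hxN)
      have hI : (φ ∘ q) x ∈ Icc (0 : ℝ) 1 := hg ▸ mem_range_self x
      right; right
      by_contra hnot
      rw [mem_insert_iff, mem_singleton_iff, not_or] at hnot
      obtain ⟨z, hzx, hz1, hz2⟩ := hz
        ⟨lt_of_le_of_ne hI.1 fun h => hnot.1 (hinj _ hxF hxN 0 (hφ0.trans h)).symm,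
          lt_of_le_of_ne hI.2 fun h => hnot.2 (hinj _ hxF hxN 1 (hφ1.trans h.symm)).symm⟩
      rcases eq_or_eq_of_fibre hq hne hqxy (hinj _ hxF hxN _ hzx) with h | h
      · exact hz1 h
      · exact hz2 h
    · rcases hxy with h | h
      · exact Or.inr (Or.inl (hPcov x y h hqxy).1)
      · exact Or.inr (Or.inl (hPcov y x h (Ne.symm hqxy)).2)
  refine ⟨_, fun t ht => ht.1, cIsomorphic_splitUnitInterval_of_fibres (hφc.comp hqc) hgm hg hJ,
    fun hSA V hV hVne hcount => ?_, φ, φ '' range ((↑) : ℚ → ℝ), (countable_range _).image φ, ?_⟩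
  · obtain ⟨s, hsV, hs⟩ := hVne
    obtain ⟨t, htF, rfl⟩ := hsurj s (Ioo_subset_Icc_self hs)
    have hW : φ ⁻¹' (V ∩ Ioo 0 1) ∈ 𝓝 t :=
      ((hV.inter isOpen_Ioo).preimage hφc).mem_nhds ⟨hsV, hs⟩
    have hcount' : ((S ∩ φ ⁻¹' (V ∩ Ioo 0 1)) ∩ (F \ N)).Countable := by
      refine countable_of_injective_of_countable_image (f := φ)
        -- Injectivity of `φ` on `F \ N` turns a countable piece of `B` into a countable piece of
        -- `S` near the condensation point `t`, a contradiction.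
        (fun a ha b hb hab => hinj b hb.2.1 hb.2.2 a hab) (hcount.mono ?_)
      rintro _ ⟨a, ⟨⟨haS, haV, ha01⟩, -⟩, rfl⟩
      have haA := hSA haS
      rw [hA] at haA
      obtain ⟨x, y, hxy, hx, hy⟩ := haA
      exact ⟨⟨ha01, x, y, hxy, congrArg φ hx, congrArg φ hy⟩, haV⟩
    refine htF _ hW (((hSF.union hN).union hcount').mono fun a ha => ?_)
    by_cases haF : a ∈ F
    · by_cases haN : a ∈ N
      · exact Or.inl (Or.inr haN)
      · exact Or.inr ⟨ha, haF, haN⟩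
    · exact Or.inl (Or.inl ⟨ha.1, haF⟩)
  · rintro t ⟨-, x, y, hxy, hx, hy⟩
    rcases (hqm hxy.le).eq_or_lt with h | h
    · left
      refine ⟨q x, ?_, hx⟩
      rw [hA]
      exact ⟨x, y, hxy, rfl, h.symm⟩
    · right
      -- If a fibre of `φ ∘ q` contains two values of `q`, then `φ` is constant between them, so the
      -- fibre is counted by a rational.
      obtain ⟨r, hr1, hr2⟩ := exists_rat_btwn h
      refine ⟨r, mem_range_self r, le_antisymm ?_ ?_⟩
      · rw [← hy]; exact hφm hr2.le
      · rw [← hx]; exact hφm hr1.le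

/-! ### Weight and the number of jumps -/

theorem topWeight_le_aleph0 (X : Type u) [TopologicalSpace X] [SecondCountableTopology X] :
    topWeight X ≤ ℵ₀ := by
  obtain ⟨b, hb, -, hbasis⟩ := exists_countable_basis X
  have h : #b ∈ {c : Cardinal.{u} | ∃ 𝓑 : Set (Set X), IsTopologicalBasis 𝓑 ∧ #𝓑 = c} :=
    ⟨b, hbasis, rfl⟩
  exact (csInf_le' h).trans (le_aleph0_iff_set_countable.2 hb)

/-- The number of jumps of a line is at most its weight. -/
theorem lift_mk_jumps_le_topWeight {K : Type u} [LinearOrder K] [TopologicalSpace K]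
    [OrderTopology K] {q : K → ℝ} (hq : ∀ x y, x < y → q x = q y → x ⋖ y) :
    Cardinal.lift.{u} #{t | ∃ x y, x < y ∧ q x = t ∧ q y = t} ≤
      Cardinal.lift.{0} (topWeight K) := by
  obtain ⟨𝓑, h𝓑, hcard⟩ : topWeight K ∈
      {c : Cardinal.{u} | ∃ 𝓑 : Set (Set K), IsTopologicalBasis 𝓑 ∧ #𝓑 = c} :=
    csInf_mem (s := {c : Cardinal.{u} | ∃ 𝓑 : Set (Set K), IsTopologicalBasis 𝓑 ∧ #𝓑 = c})
      ⟨_, _, isTopologicalBasis_opens, rfl⟩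
  rw [← hcard]
  -- The lower end `x` of a jump has the open neighbourhood `Iic x`; a basic set between `{x}` and
  -- `Iic x` has maximum `x` and so determines the jump.
  have h : ∀ t : {t | ∃ x y, x < y ∧ q x = t ∧ q y = t}, ∃ (x : K) (b : 𝓑), q x = t ∧
      x ∈ (b : Set K) ∧ (b : Set K) ⊆ Iic x := by
    rintro ⟨_, x, y, hxy, rfl, hy⟩
    have hcov := hq x y hxy hy.symm
    have hopen : IsOpen (Iic x) := by
      rw [← hcov.Iio_eq]; exact isOpen_Iio
    obtain ⟨b, hb, hxb, hsub⟩ := h𝓑.exists_subset_of_mem_open (self_mem_Iic (a := x)) hopen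
    exact ⟨x, ⟨b, hb⟩, rfl, hxb, hsub⟩
  choose x b hx hxb hb using h
  refine Cardinal.lift_mk_le_lift_mk_of_injective (f := b) fun s t hst => ?_
  have h1 : x s ≤ x t := hb t (hst ▸ hxb s)
  have h2 : x t ≤ x s := hb s (hst ▸ hxb t)
  exact Subtype.ext (by rw [← hx s, ← hx t, le_antisymm h1 h2])

/-- A second map `p`, chosen to glue none of the countably many pairs glued by `q`, makes `(q, p)`
an embedding into the plane. -/
theorem secondCountable_of_countable_jumps {K : Type u} [LinearOrder K] [TopologicalSpace K]
    [OrderTopology K] [CompactSpace K] [SeparableSpace K] {q : K → ℝ} (hqc : Continuous q)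
    (hq : ∀ x y, x < y → q x = q y → x ⋖ y)
    (hA : {t | ∃ x y, x < y ∧ q x = t ∧ q y = t}.Countable) : SecondCountableTopology K := by
  obtain ⟨p, hpc, -, -, hp⟩ :=
    exists_monotone_continuous_gluing_jumps (hA.preimage_of_countable_fibre hq)
  have hlt : ∀ x y, x < y → q x = q y → p x ≠ p y := fun x y hxy hqxy hpxy =>
    (hp x y hxy hpxy).2.1 ⟨x, y, hxy, rfl, hqxy.symm⟩
  have hinj : Function.Injective fun x => (q x, p x) := fun x y h => by
    rw [Prod.mk.injEq] at h
    by_contra hne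
    rcases lt_or_gt_of_ne hne with hxy | hxy
    · exact hlt x y hxy h.1 h.2
    · exact hlt y x hxy h.1.symm h.2.symm
  exact ((hqc.prodMk hpc).isClosedEmbedding hinj).isEmbedding.secondCountableTopology

/-! ### The two statements -/

theorem mainTheorem8 :
    (∀ (K : Type u) [LinearOrder K] [TopologicalSpace K] [OrderTopology K] [CompactSpace K]
        [SeparableSpace K], topWeight K = ℵ₁ →
      ∃ B : Set ℝ, B ⊆ Ioo 0 1 ∧
        IsCardDense ℵ₁ ((↑) ⁻¹' B : Set (Ioo (0 : ℝ) 1)) ∧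
        CIsomorphic K (SplitUnitInterval B)) ∧
    (∀ (L : Type u) [LinearOrder L] [TopologicalSpace L] [OrderTopology L] [CompactSpace L]
        [SeparableSpace L] [Uncountable L],
      ∃ A : Set ℝ, A ⊆ Ioo 0 1 ∧ CIsomorphic L (SplitUnitInterval A)) := by
  constructor
  · intro K _ _ _ _ _ hK
    obtain ⟨q, hqc, hqm, hq01, hq⟩ :=
      exists_monotone_continuous_gluing_jumps (K := K) countable_empty
    have hq : ∀ x y, x < y → q x = q y → x ⋖ y := fun x y hxy h => (hq x y hxy h).1
    set A : Set ℝ := {t | ∃ x y, x < y ∧ q x = t ∧ q y = t} with hA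
    have hAunc : ¬ A.Countable := fun h => by
      have := secondCountable_of_countable_jumps hqc hq h
      have := topWeight_le_aleph0 K
      rw [hK] at this
      exact this.not_gt aleph0_lt_aleph_one
    have hAcard : #A ≤ ℵ₁ := by
      have := lift_mk_jumps_le_topWeight hq
      rw [hK] at this
      simpa using this
    obtain ⟨B, hB, hKB, hdense, φ, C, hC, hBC⟩ := exists_cIsomorphic_of_uncountable hqc hqm hq01 hq
      hA Subset.rfl (by rintro t ⟨x, y, -, hx, -⟩; exact ⟨x, hx⟩) hAunc
    have hBcard : #B ≤ ℵ₁ := by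
      refine (mk_le_mk_of_subset hBC).trans ((mk_union_le _ _).trans ?_)
      refine add_le_of_le aleph0_lt_aleph_one.le (mk_image_le.trans hAcard) ?_
      exact (le_aleph0_iff_set_countable.2 hC).trans aleph0_lt_aleph_one.le
    refine ⟨B, hB, fun U hU hUne => le_antisymm ?_ ?_, hKB⟩
    · refine le_trans ?_ hBcard
      exact Cardinal.mk_le_of_injective
        (f := fun x : (U ∩ Subtype.val ⁻¹' B : Set (Ioo (0 : ℝ) 1)) =>
          (⟨(x : Ioo (0 : ℝ) 1), x.2.2⟩ : B))
        fun x y h => Subtype.ext (Subtype.ext (congrArg (fun b : B => (b : ℝ)) h))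
    · rw [← succ_aleph0]
      refine Order.succ_le_of_lt (not_le.1 fun h => ?_)
      rw [le_aleph0_iff_set_countable] at h
      obtain ⟨V, hV, rfl⟩ := isOpen_induced_iff.1 hU
      obtain ⟨x, hx⟩ := hUne
      refine hdense Subset.rfl V hV ⟨x, hx, x.2⟩ ((h.image Subtype.val).mono ?_)
      exact fun t ht => ⟨⟨t, hB ht.1⟩, ⟨ht.2, ht.1⟩, rfl⟩
  · intro L _ _ _ _ _ _
    obtain ⟨q, hqc, hqm, hq01, hq⟩ :=
      exists_monotone_continuous_gluing_jumps (K := L) countable_empty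
    have hq : ∀ x y, x < y → q x = q y → x ⋖ y := fun x y hxy h => (hq x y hxy h).1
    -- Here `S = range q`, which is uncountable because `L` is and the fibres of `q` are countable.
    obtain ⟨B, hB, hLB, -⟩ := exists_cIsomorphic_of_uncountable hqc hqm hq01 hq rfl
      (by rintro t ⟨x, y, -, hx, -⟩; exact ⟨x, hx⟩) Subset.rfl fun h => by
        have := h.preimage_of_countable_fibre hq
        rw [preimage_range] at this
        exact not_countable_univ this
    exact ⟨B, hB, hLB⟩
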